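/- \textbf{Setting.} Let $\beta\in(0,1)$, $\delta\ge 0$ with $\delta\neq 1$, $\rho\in(-1,1)$, $\tilde c_0>0$, $\mu_\eta\in\mathbb R$ and $\gamma_u,\gamma_\xi,\gamma_\eta>0$. Write $LN(\mu,\gamma)$ for the law of $e^X$ with $X\sim N(\mu,\gamma)$ ($\gamma$ the variance), and let $u(w)=w^{1-\delta}/(1-\delta)$, $r(w)=u(w)/(1-\beta)$ and $c_0=u(\tilde c_0)$. Let $Z_t=(w_t,\theta_t)$ be the Markov process on $\mathsf Z=(0,\infty)^2$ with $$\ln\theta_{t+1}=\rho\ln\theta_t+\ln u_{t+1},\qquad w_{t+1}=\eta_{t+1}+\theta_{t+1}\xi_{t+1},$$ where the shocks $u_t\sim LN(0,\gamma_u)$, $\xi_t\sim LN(0,\gamma_\xi)$, $\eta_t\sim LN(\mu_\eta,\gamma_\eta)$ are i.i.d. over time and independent of each other. Let $\mathbb P_z$, $\mathbb E_z$ be its law and expectation on the sequence space given $Z_0=z$, and let $\mathbb E_\theta$ be the expectation of functions of $(Z_1,Z_2,\dots)$ given $\theta_0=\theta$ (this does not depend on $w_0$). We write $(w',\theta')$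 for $Z_1$. Define $$v^*(z)=\sup_\tau \mathbb E_z\Big\{\sum_{t=0}^{\tau-1}\beta^t c_0+\beta^\tau r(w_\tau)\Big\},\qquad \psi^*(\theta)=c_0+\beta\,\mathbb E_\theta v^*(w',\theta'),\qquad Q\psi(\theta)=c_0+\beta\,\mathbb E_\theta\max\{r(w'),\psi(\theta')\},$$ where $\tau$ ranges over the $\mathbb P_z$-a.s. finite stopping times of the filtration generated by $(Z_t)$. A policy $\sigma:\mathsf Z\to\{0,1\}$ is optimal if, for every $z$, $\inf\{t\ge0:\sigma(Z_t)=1\}$ is such a stopping time and attains the supremum. The reservation wage $\bar w(\theta)$ is the wage with $r(\bar w(\theta))=\psi^*(\theta)$. For $n\in\{0,1,2,\dots\}$ put $m=e^{\rho^{2n}(1-\delta)^2\gamma_u}$ and $g(\theta)=\theta^{(1-\delta)\rho^n}+\theta^{-(1-\delta)\rho^n}$. Call $(n,a,b,m',d')$ admissible if $\beta m<1$, $a>0$, $b\ge0$, $m',d'>0$, $m+2m'>1$, $\beta(m+2m')<1$, $d'\ge am/(m+2m'-1)$ and, if $n\ge2$, $\mathbb E_\theta|r(w_n)|\le a\,g(\theta)+b$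 for all $\theta$ (for $n\le 1$ one may take $a=1$, $b=0$). The associated weight function is $$\ell(\theta)=m'\Big(\sum_{t=1}^{n-1}\mathbb E_\theta|r(w_t)|+n|c_0|\Big)+a\,g(\theta)+b+d'.$$ Let $b_\ell$ be the set of measurable $f:(0,\infty)\to\mathbb R$ with $\|f\|_\ell=\sup_\theta|f(\theta)|/\ell(\theta)<\infty$. \textbf{Proposition.} The following hold; all expectations above, and all those in $Q\psi$ for $\psi\in b_\ell$, are those of integrable random variables, and the supremum defining $v^*$ is finite. 0. There is an $n$ with $\beta m<1$, and for every such $n$ there are $a,b,m',d'$ such that $(n,a,b,m',d')$ is admissible. 1. For every admissible choice, $\ell>0$, $Q$ is a contraction mapping of $(b_\ell,\|\cdot\|_\ell)$ into itself, and $\psi^*$ belongs to $b_\ell$ and is the unique fixed point of $Q$ in $b_\ell$. 2. For all $(w,\theta)\in\mathsf Z$, $v^*(w,\theta)=\max\Big\{\dfrac{w^{1-\delta}}{(1-\beta)(1-\delta)},\,\psi^*(\theta)\Big\}$. Moreover $(1-\beta)(1-\delta)\psi^*(\theta)>0$, the reservation wage exists, is unique and equals $\bar w(\theta)=[(1-\beta)(1-\delta)\psi^*(\theta)]^{1/(1-\delta)}$,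 and the policy $\sigma^*(w,\theta)=\mathbf 1\{w\ge\bar w(\theta)\}$ is optimal. 3. $\psi^*$ and $\bar w$ are continuously differentiable on $(0,\infty)$, and $v^*$ is continuous on $\mathsf Z$. 4. $v^*$ is (weakly) increasing in $w$; if $\rho\ge0$, then $\psi^*$, $v^*$ and $\bar w$ are (weakly) increasing in $\theta$. -/

import Mathlib

open MeasureTheory ProbabilityTheory Set
open scoped NNReal

noncomputable section

/-! ### Optimal stopping for a Markov process with stochastic kernel `P` on `Z` -/

namespace OptStop

/-- The law `ℙ_z` on the sequence space `ℕ → Z` of the Markov process `(Z_t)` with stochastic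
kernel `P` started at `Z_0 = z` (Ionescu-Tulcea). -/
def pathMeasure {Z : Type} [MeasurableSpace Z] (P : Kernel Z Z) [IsMarkovKernel P] (z : Z) :
    Measure (ℕ → Z) :=
  Kernel.traj (X := fun _ : ℕ => Z)
    (fun n => P.comap (fun h : (i : Finset.Iic n) → Z => h ⟨n, Finset.mem_Iic.2 le_rfl⟩)
      (measurable_pi_apply _)) 0 (fun _ => z)

/-- `τ` is a stopping time for the filtration generated by `(Z_t)`, finite `ℙ_z`-almost surely. -/
def IsFiniteStoppingTime {Z : Type} [MeasurableSpace Z] (P : Kernel Z Z) [IsMarkovKernel P]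
    (z : Z) (τ : (ℕ → Z) → WithTop ℕ) : Prop :=
  IsStoppingTime (Filtration.piLE (X := fun _ : ℕ => Z)) τ ∧ ∀ᵐ ω ∂(pathMeasure P z), τ ω ≠ ⊤

/-- The realized payoff `∑_{t < τ} β^t c(Z_t) + β^τ r(Z_τ)`. -/
def payoff {Z : Type} (β : ℝ) (r c : Z → ℝ) (τ : (ℕ → Z) → WithTop ℕ) (ω : ℕ → Z) : ℝ :=
  (∑ t ∈ Finset.range ((τ ω).untopD 0), β ^ t * c (ω t))
    + β ^ ((τ ω).untopD 0) * r (ω ((τ ω).untopD 0))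

/-- The value function `v*(z) = sup_τ 𝔼_z {∑_{t < τ} β^t c(Z_t) + β^τ r(Z_τ)}`. -/
def value {Z : Type} [MeasurableSpace Z] (P : Kernel Z Z) [IsMarkovKernel P]
    (β : ℝ) (r c : Z → ℝ) (z : Z) : ℝ :=
  ⨆ τ : {τ : (ℕ → Z) → WithTop ℕ // IsFiniteStoppingTime P z τ},
    ∫ ω, payoff β r c τ.1 ω ∂(pathMeasure P z)

/-- The supremum defining `v*` is meaningful: for every initial state, every admissible payoff is
integrable, and the expected payoffs are bounded above. -/
def ValueWellDefined {Z : Type} [MeasurableSpace Z] (P : Kernel Z Z) [IsMarkovKernel P]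
    (β : ℝ) (r c : Z → ℝ) : Prop :=
  ∀ z, (∀ τ, IsFiniteStoppingTime P z τ → Integrable (payoff β r c τ) (pathMeasure P z)) ∧
    BddAbove (range fun τ : {τ : (ℕ → Z) → WithTop ℕ // IsFiniteStoppingTime P z τ} =>
      ∫ ω, payoff β r c τ.1 ω ∂(pathMeasure P z))

/-- The policy that stops exactly in the states of `S` (i.e. `σ = 𝟙_S`) is optimal: for every
initial state, the first time at which `Z_t ∈ S` is a finite stopping time attaining the supremum
in the definition of the value function. -/
def IsOptimalPolicy {Z : Type} [MeasurableSpace Z] (P : Kernel Z Z) [IsMarkovKernel P]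
    (β : ℝ) (r c : Z → ℝ) (S : Set Z) : Prop :=
  ∀ z, IsFiniteStoppingTime P z (hittingAfter (fun (t : ℕ) (ω : ℕ → Z) => ω t) S 0) ∧
    ∫ ω, payoff β r c (hittingAfter (fun (t : ℕ) (ω : ℕ → Z) => ω t) S 0) ω ∂(pathMeasure P z)
      = value P β r c z

end OptStop

/-! ### Weighted supremum norms -/

/-- `f ∈ b_ℓ Y`: `f` is measurable and `ℓ`-bounded. -/
def MemWeighted {Y : Type} [MeasurableSpace Y] (ℓ f : Y → ℝ) : Prop :=
  Measurable f ∧ BddAbove (range fun y => |f y| / ℓ y)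

/-- The `ℓ`-weighted supremum norm `sup_y |f(y)| / ℓ(y)`. -/
def weightedNorm {Y : Type} (ℓ f : Y → ℝ) : ℝ := ⨆ y, |f y| / ℓ y

/-- `Q` is a contraction mapping of `(b_ℓ Y, ‖·‖_ℓ)` into itself. -/
def IsWeightedContraction {Y : Type} [MeasurableSpace Y] (ℓ : Y → ℝ)
    (Q : (Y → ℝ) → (Y → ℝ)) : Prop :=
  (∀ ψ, MemWeighted ℓ ψ → MemWeighted ℓ (Q ψ)) ∧
    ∃ k : ℝ, 0 ≤ k ∧ k < 1 ∧ ∀ ψ φ, MemWeighted ℓ ψ → MemWeighted ℓ φ →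
      weightedNorm ℓ (Q ψ - Q φ) ≤ k * weightedNorm ℓ (ψ - φ)

/-! ### The job search model -/

/-- The positive half line `(0, ∞)`. -/
abbrev PosReal : Type := Ioi (0 : ℝ)

/-- `f : (0, ∞) → ℝ` is continuously differentiable. -/
def IsC1 (f : PosReal → ℝ) : Prop :=
  ∃ F : ℝ → ℝ, ContDiffOn ℝ 1 F (Ioi 0) ∧ ∀ x : PosReal, F x = f x

/-- The lognormal distribution `LN(μ, γ)`: the law of `exp X` with `X ∼ N(μ, γ)`. -/
def logNormal (μ : ℝ) (γ : ℝ≥0) : Measure PosReal :=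
  (gaussianReal μ γ).map fun x => (⟨Real.exp x, Real.exp_pos x⟩ : PosReal)

lemma measurable_posExp :
    Measurable fun x : ℝ => (⟨Real.exp x, Real.exp_pos x⟩ : PosReal) :=
  Real.measurable_exp.subtype_mk

instance (μ : ℝ) (γ : ℝ≥0) : IsProbabilityMeasure (logNormal μ γ) :=
  Measure.isProbabilityMeasure_map measurable_posExp.aemeasurable

/-- CRRA utility with relative risk aversion `δ`. -/
def crra (δ w : ℝ) : ℝ := if δ = 1 then Real.log w else w ^ (1 - δ) / (1 - δ)

/-- Parameters of the model: discount factor `β`, relative risk aversion `δ`, persistence `ρ`,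
unemployment compensation `comp`, and the lognormal parameters of the shocks
`u ∼ LN(0, γu)`, `ξ ∼ LN(0, γξ)`, `η ∼ LN(μη, γη)`. -/
structure JobSearch where
  β : ℝ
  δ : ℝ
  ρ : ℝ
  comp : ℝ
  μη : ℝ
  γu : ℝ≥0
  γξ : ℝ≥0
  γη : ℝ≥0

namespace JobSearch

/-- Joint law of the independent shocks `(u, ξ, η)`. -/
def shockLaw (M : JobSearch) : Measure (PosReal × PosReal × PosReal) :=
  (logNormal 0 M.γu).prod ((logNormal 0 M.γξ).prod (logNormal M.μη M.γη))

instance (M : JobSearch) : IsProbabilityMeasure M.shockLaw := by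
  unfold shockLaw; infer_instance

/-- The next persistent component: `ln θ' = ρ ln θ + ln u`, i.e. `θ' = θ ^ ρ * u`. -/
def nextTheta (M : JobSearch) (θ u : PosReal) : PosReal :=
  ⟨(θ : ℝ) ^ M.ρ * (u : ℝ), mul_pos (Real.rpow_pos_of_pos θ.2 _) u.2⟩

/-- The wage `w = η + θ ξ`. -/
def wage (θ ξ η : PosReal) : PosReal :=
  ⟨(η : ℝ) + (θ : ℝ) * (ξ : ℝ), mem_Ioi.2 (add_pos (mem_Ioi.1 η.2) (mul_pos θ.2 ξ.2))⟩

/-- The next state `(w', θ')` as a function of `θ` and the shocks `(u, ξ, η)`. -/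
def next (M : JobSearch) (θ : PosReal) (s : PosReal × PosReal × PosReal) : PosReal × PosReal :=
  (wage (M.nextTheta θ s.1) s.2.1 s.2.2, M.nextTheta θ s.1)

lemma measurable_next (M : JobSearch) :
    Measurable fun p : PosReal × PosReal × PosReal × PosReal => M.next p.1 p.2 := by
  have h : Measurable fun p : PosReal × PosReal × PosReal × PosReal => M.nextTheta p.1 p.2.1 := by
    unfold nextTheta
    exact Measurable.subtype_mk (by fun_prop)
  refine Measurable.prodMk ?_ h
  unfold wage
  exact Measurable.subtype_mk (by fun_prop)

/-- The conditional law of the next state `(w', θ')` given the current `θ`. -/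
def thetaKernel (M : JobSearch) : Kernel PosReal (PosReal × PosReal) where
  toFun θ := M.shockLaw.map (M.next θ)
  measurable' := by
    have h : (fun θ => M.shockLaw.map (M.next θ)) = fun θ =>
        (M.shockLaw.map (Prod.mk θ)).map
          fun p : PosReal × PosReal × PosReal × PosReal => M.next p.1 p.2 := by
      funext θ
      rw [Measure.map_map M.measurable_next measurable_prodMk_left]
      rfl
    rw [h]
    exact (Measure.measurable_map _ M.measurable_next).comp Measurable.map_prodMk_left

instance (M : JobSearch) : IsMarkovKernel M.thetaKernel :=
  ⟨fun _ => Measure.isProbabilityMeasure_map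
    (M.measurable_next.comp measurable_prodMk_left).aemeasurable⟩

/-- The stochastic kernel of the state process `Z_t = (w_t, θ_t)`. -/
def kernel (M : JobSearch) : Kernel (PosReal × PosReal) (PosReal × PosReal) :=
  M.thetaKernel.comap Prod.snd measurable_snd

instance (M : JobSearch) : IsMarkovKernel M.kernel := by
  unfold kernel; infer_instance

/-- The exit payoff `r(w) = u(w) / (1 - β)`. -/
def r (M : JobSearch) (w : PosReal) : ℝ := crra M.δ w / (1 - M.β)

/-- The flow continuation payoff, the constant `c₀ = u(comp)`. -/
def c₀ (M : JobSearch) : ℝ := crra M.δ M.comp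

/-- The value function `v*(w, θ)`. -/
def value (M : JobSearch) : PosReal × PosReal → ℝ :=
  OptStop.value M.kernel M.β (fun z => M.r z.1) (fun _ => M.c₀)

/-- The continuation value function
`ψ*(θ) = c₀ + β 𝔼[v*(w', θ') | θ]`. -/
def contValue (M : JobSearch) (θ : PosReal) : ℝ :=
  M.c₀ + M.β * ∫ z, M.value z ∂(M.thetaKernel θ)

/-- The continuation value (Jovanovic) operator
`Qψ(θ) = c₀ + β 𝔼[max {r(w'), ψ(θ')} | θ]`. -/
def Q (M : JobSearch) (ψ : PosReal → ℝ) (θ : PosReal) : ℝ :=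
  M.c₀ + M.β * ∫ z, max (M.r z.1) (ψ z.2) ∂(M.thetaKernel θ)

/-- `stateLaw k θ` is the law of `Z_{k+1} = (w_{k+1}, θ_{k+1})` given `θ_0 = θ`. -/
def stateLaw (M : JobSearch) : ℕ → Kernel PosReal (PosReal × PosReal)
  | 0 => M.thetaKernel
  | k + 1 => M.kernel ∘ₖ stateLaw M k

/-- `𝔼_θ |r(Z_{k+1})|`, which does not depend on the initial wage. -/
def absExit (M : JobSearch) (k : ℕ) (θ : PosReal) : ℝ :=
  ∫ z, |M.r z.1| ∂(M.stateLaw k θ)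

/-- `m = e^{ρ^{2n} (1 - δ)² γu}`. -/
def m (M : JobSearch) (n : ℕ) : ℝ := Real.exp (M.ρ ^ (2 * n) * ((1 - M.δ) ^ 2 * (M.γu : ℝ)))

/-- `g(θ) = θ^{(1-δ) ρ^n} + θ^{-(1-δ) ρ^n}`. -/
def g (M : JobSearch) (n : ℕ) (θ : PosReal) : ℝ :=
  (θ : ℝ) ^ ((1 - M.δ) * M.ρ ^ n) + (θ : ℝ) ^ (-((1 - M.δ) * M.ρ ^ n))

/-- The constants entering the weight function are admissible. The drift bound is
`𝔼_θ g(θ') ≤ m g(θ) + m`, so that `a g + b` has drift constants `m` and `d = a m`. The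
normalization of `g` by `a` and `b` is required to dominate `𝔼_θ |r(Z_n)|` when this expectation
enters the drift of the weight, that is, for `n ≥ 2`; for `n ≤ 1` every `a > 0` and `b ≥ 0` is
allowed, in particular `a = 1`, `b = 0`. -/
structure IsAdmissible (M : JobSearch) (n : ℕ) (a b m' d' : ℝ) : Prop where
  discount : M.β * M.m n < 1
  a_pos : 0 < a
  b_nonneg : 0 ≤ b
  bound : ∀ k, n = k + 2 → ∀ θ, M.absExit (k + 1) θ ≤ a * M.g n θ + b
  m'_pos : 0 < m'
  d'_pos : 0 < d'
  one_lt : 1 < M.m n + 2 * m'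
  lt_one : M.β * (M.m n + 2 * m') < 1
  d'_ge : a * M.m n / (M.m n + 2 * m' - 1) ≤ d'

/-- The weight function
`ℓ(θ) = m' (∑_{t=1}^{n-1} 𝔼_θ |r(Z_t)| + ∑_{t=0}^{n-1} |c₀|) + (a g(θ) + b) + d'`. -/
def ell (M : JobSearch) (n : ℕ) (a b m' d' : ℝ) (θ : PosReal) : ℝ :=
  m' * ((∑ k ∈ Finset.range (n - 1), M.absExit k θ) + n * |M.c₀|) + (a * M.g n θ + b) + d'

end JobSearch

end

/-! The Jovanovic operator replaces the two-variable Bellman equation by a fixed point problem in θ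
alone. The analytic input is a weight ℓ with E_θ ℓ(θ') ≤ K ℓ(θ), K = m + 2m', βK < 1
(`IsAdmissible.isWeight`). Lognormal moments turn θ'^p into a multiple of θ^{pρ}, so the expected
exit payoff n steps ahead grows at most like the power (1-δ)ρ^n. The symmetrized power g has drift
factor at most m, which is close to 1 for large n. The exit payoffs at earlier dates are carried in
ℓ as a sum that shifts by one under the transition. Since max{r, ·} is 1-Lipschitz, Q contracts with
modulus βK, and its iterates from 0 converge to a fixed point ψ (`exists_fixed`).

To identify ψ with ψ*, put v = max{r, ψ}. Then Qψ = ψ reads c₀ + βPv = ψ ≤ v, so v is an excessive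
majorant of r. Discounted payoffs are written as series of one-step increments over the events {j <
τ}, which are known at time j. By the Markov property v dominates every expected payoff, with
equality for the first entrance into {r ≥ ψ} (`value_eq_and_isOptimalPolicy`). A multiple of ℓ plus
|r| supplies the integrability.

It remains to see that this entrance time is almost surely finite. The process log θ is
autoregressive with |ρ| < 1, hence tight, and from bounded log θ the wage crosses a continuous
threshold next period with probability bounded below (`isFiniteStoppingTime_threshold`). The
threshold is continuous because a shift of the Gaussian log θ' only inserts an exponential density:
expectations become moment generating functions evaluated along log θ, hence C¹ in θ
(`isC1_integral_thetaKernel`). Monotonicity, and the sign of ψ when δ > 1, are inherited from the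
iterates of Q. -/

noncomputable section

namespace OptStop

open scoped ENNReal
open Preorder

/-! ### Path measures and the Markov property. -/

section PathMeasure

variable {Z : Type} [MeasurableSpace Z] (P : Kernel Z Z) [IsMarkovKernel P] (z : Z)

instance : IsProbabilityMeasure (pathMeasure P z) := by
  unfold pathMeasure; infer_instance

lemma map_eval_zero_pathMeasure :
    (pathMeasure P z).map (fun ω : ℕ → Z => ω 0) = Measure.dirac z := by
  have h : (fun ω : ℕ → Z => ω 0) =
      (fun x : (i : Finset.Iic 0) → Z => x ⟨0, Finset.mem_Iic.2 le_rfl⟩) ∘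
        frestrictLe (π := fun _ => Z) 0 := rfl
  rw [h, ← Measure.map_map (g := fun x : (i : Finset.Iic 0) → Z => x ⟨0, Finset.mem_Iic.2 le_rfl⟩)
      (measurable_pi_apply _) (measurable_frestrictLe 0), pathMeasure,
    Kernel.traj_map_frestrictLe_apply, Kernel.partialTraj_self, Kernel.id_apply]
  exact Measure.map_dirac' (measurable_pi_apply _) _

/-- The Markov property: the joint law of the history up to time `n` and the next state. -/
lemma map_history_next_pathMeasure (n : ℕ) :
    (pathMeasure P z).map (fun ω : ℕ → Z => (frestrictLe (π := fun _ => Z) n ω, ω (n + 1))) =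
      ((pathMeasure P z).map (frestrictLe (π := fun _ => Z) n)) ⊗ₘ
        P.comap (fun h : (i : Finset.Iic n) → Z => h ⟨n, Finset.mem_Iic.2 le_rfl⟩)
          (measurable_pi_apply _) := by
  rw [pathMeasure, Kernel.traj_map_frestrictLe_apply]
  exact (Kernel.partialTraj_compProd_eq_map_traj (X := fun _ => Z) (Nat.zero_le n)).symm

variable {P z}

lemma lintegral_eval_zero {f : Z → ℝ≥0∞} (hf : Measurable f) :
    ∫⁻ ω, f (ω 0) ∂(pathMeasure P z) = f z := by
  rw [← lintegral_map hf (measurable_pi_apply 0), map_eval_zero_pathMeasure, lintegral_dirac' _ hf]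

lemma integral_eval_zero {f : Z → ℝ} (hf : Measurable f) :
    ∫ ω, f (ω 0) ∂(pathMeasure P z) = f z := by
  rw [← integral_map (φ := fun ω : ℕ → Z => ω 0) (measurable_pi_apply 0).aemeasurable
    hf.aestronglyMeasurable, map_eval_zero_pathMeasure,
    integral_dirac' _ _ hf.stronglyMeasurable]

/-- An event of time n is the preimage of a set B of histories, so the integral lives on B × Z under
the joint law of history and next state, which is a composition product. -/
lemma setLIntegral_eval_succ {f : Z → ℝ≥0∞} (hf : Measurable f) {n : ℕ} {A : Set (ℕ → Z)}
    (hA : MeasurableSet[Filtration.piLE (X := fun _ : ℕ => Z) n] A) :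
    ∫⁻ ω in A, f (ω (n + 1)) ∂(pathMeasure P z) =
      ∫⁻ ω in A, ∫⁻ y, f y ∂(P (ω n)) ∂(pathMeasure P z) := by
  rw [Filtration.piLE_eq_comap_frestrictLe] at hA
  obtain ⟨B, hB, rfl⟩ := hA
  have hm : Measurable fun ω : ℕ → Z => (frestrictLe (π := fun _ => Z) n ω, ω (n + 1)) := by
    fun_prop
  have h1 : ∫⁻ p in B ×ˢ univ, f p.2 ∂((pathMeasure P z).map
      (fun ω : ℕ → Z => (frestrictLe (π := fun _ => Z) n ω, ω (n + 1)))) =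
      ∫⁻ ω in frestrictLe (π := fun _ => Z) n ⁻¹' B, f (ω (n + 1)) ∂(pathMeasure P z) := by
    rw [setLIntegral_map (hB.prod .univ) (by fun_prop) hm]
    congr 2
    ext ω; simp
  rw [← h1, map_history_next_pathMeasure, Measure.setLIntegral_compProd (by fun_prop) hB .univ,
    setLIntegral_map hB _ (by fun_prop)]
  · simp
  · simp only [Measure.restrict_univ]
    exact hf.lintegral_kernel

lemma setIntegral_eval_succ {f : Z → ℝ} (hf : Measurable f) {n : ℕ} {A : Set (ℕ → Z)}
    (hA : MeasurableSet[Filtration.piLE (X := fun _ : ℕ => Z) n] A)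
    (hi : Integrable (fun ω : ℕ → Z => f (ω (n + 1))) (pathMeasure P z)) :
    ∫ ω in A, f (ω (n + 1)) ∂(pathMeasure P z) =
      ∫ ω in A, ∫ y, f y ∂(P (ω n)) ∂(pathMeasure P z) := by
  rw [Filtration.piLE_eq_comap_frestrictLe] at hA
  obtain ⟨B, hB, rfl⟩ := hA
  have hm : Measurable fun ω : ℕ → Z => (frestrictLe (π := fun _ => Z) n ω, ω (n + 1)) := by
    fun_prop
  have h1 : ∫ p in B ×ˢ univ, f p.2 ∂((pathMeasure P z).map
      (fun ω : ℕ → Z => (frestrictLe (π := fun _ => Z) n ω, ω (n + 1)))) =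
      ∫ ω in frestrictLe (π := fun _ => Z) n ⁻¹' B, f (ω (n + 1)) ∂(pathMeasure P z) := by
    rw [setIntegral_map (f := fun p : ((i : Finset.Iic n) → Z) × Z => f p.2) (hB.prod .univ)
      (hf.comp measurable_snd).aestronglyMeasurable
      hm.aemeasurable]
    congr 2
    ext ω; simp
  have hi' : Integrable (fun p : ((i : Finset.Iic n) → Z) × Z => f p.2)
      ((pathMeasure P z).map
        (fun ω : ℕ → Z => (frestrictLe (π := fun _ => Z) n ω, ω (n + 1)))) :=
    (integrable_map_measure (hf.comp measurable_snd).aestronglyMeasurable hm.aemeasurable).2 hi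
  rw [map_history_next_pathMeasure] at hi'
  rw [← h1, map_history_next_pathMeasure,
    Measure.setIntegral_compProd hB .univ hi'.integrableOn, setIntegral_map hB _ (by fun_prop)]
  · simp
  · simp only [Measure.restrict_univ]
    exact ((hf.comp measurable_snd).stronglyMeasurable.integral_kernel_prod_right'
      (κ := P.comap (fun h : (i : Finset.Iic n) → Z => h ⟨n, Finset.mem_Iic.2 le_rfl⟩)
          (measurable_pi_apply _))).aestronglyMeasurable

lemma lintegral_eval_succ {f : Z → ℝ≥0∞} (hf : Measurable f) (n : ℕ) :
    ∫⁻ ω, f (ω (n + 1)) ∂(pathMeasure P z) =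
      ∫⁻ ω, ∫⁻ y, f y ∂(P (ω n)) ∂(pathMeasure P z) := by
  simpa using setLIntegral_eval_succ (P := P) (z := z) hf (n := n) MeasurableSet.univ

end PathMeasure

/-! ### Growth of weights along the process. -/

section Drift

variable {Z : Type} [MeasurableSpace Z] {P : Kernel Z Z} [IsMarkovKernel P]

lemma lintegral_eval_le_of_drift {V : Z → ℝ≥0∞} (hV : Measurable V) {K : ℝ≥0∞}
    (hK : ∀ z, ∫⁻ y, V y ∂(P z) ≤ K * V z) (z : Z) (n : ℕ) :
    ∫⁻ ω, V (ω n) ∂(pathMeasure P z) ≤ K ^ n * V z := by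
  induction n with
  | zero => simp [lintegral_eval_zero hV]
  | succ n ih =>
    rw [lintegral_eval_succ hV]
    calc _ ≤ ∫⁻ ω, K * V (ω n) ∂(pathMeasure P z) := lintegral_mono fun ω => hK _
      _ = K * ∫⁻ ω, V (ω n) ∂(pathMeasure P z) := lintegral_const_mul _ (by fun_prop)
      _ ≤ K * (K ^ n * V z) := by gcongr
      _ = _ := by rw [pow_succ]; ring

end Drift

end OptStop

namespace OptStop

open scoped ENNReal
open Preorder

/-! ### Verification theorem for optimal stopping. -/

section Verification

variable {Z : Type}

/-- `V` is a weight whose expected growth rate `K` under `P` is beaten by discounting. -/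
structure IsDriftWeight [MeasurableSpace Z] (P : Kernel Z Z) (β : ℝ) (V : Z → ℝ≥0∞) (K : ℝ≥0∞) : Prop where
  measurable : Measurable V
  ne_top : ∀ z, V z ≠ ⊤
  drift : ∀ z, ∫⁻ y, V y ∂(P z) ≤ K * V z
  discount : ENNReal.ofReal β * K < 1

/-- The discounted increment `β^j (c + β f(Z_{j+1}) - f(Z_j))`. -/
def increment (β c : ℝ) (f : Z → ℝ) (j : ℕ) (ω : ℕ → Z) : ℝ :=
  β ^ j * (c + β * f (ω (j + 1)) - f (ω j))

lemma sum_increment (β c : ℝ) (f : Z → ℝ) (ω : ℕ → Z) (n : ℕ) :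
    f (ω 0) + ∑ j ∈ Finset.range n, increment β c f j ω =
      (∑ t ∈ Finset.range n, β ^ t * c) + β ^ n * f (ω n) := by
  induction n with
  | zero => simp
  | succ n ih =>
    rw [Finset.sum_range_succ, Finset.sum_range_succ, ← add_assoc, ih, increment]
    ring

/-- A sum with a random number of terms becomes a fixed series with indicators, so that sum and
expectation can be exchanged and each term treated by the Markov property at its own date. -/
lemma payoff_eq_tsum (β c : ℝ) (f : Z → ℝ) {τ : (ℕ → Z) → WithTop ℕ} {ω : ℕ → Z}
    (hω : τ ω ≠ ⊤) :
    payoff β f (fun _ => c) τ ω =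
      f (ω 0) + ∑' j : ℕ, {ω | (j : WithTop ℕ) < τ ω}.indicator (increment β c f j) ω := by
  obtain ⟨n, hn⟩ := WithTop.ne_top_iff_exists.1 hω
  rw [payoff, ← hn, WithTop.untopD_coe, ← sum_increment,
    tsum_eq_sum (s := Finset.range n)]
  · congr 1
    refine Finset.sum_congr rfl fun j hj => ?_
    rw [indicator_of_mem]
    rw [mem_ofPred_eq, ← hn]
    exact WithTop.coe_lt_coe.2 (Finset.mem_range.1 hj)
  · intro j hj
    rw [indicator_of_notMem]
    rw [mem_ofPred_eq, ← hn, not_lt]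
    exact WithTop.coe_le_coe.2 (not_lt.1 fun h => hj (Finset.mem_range.2 h))

variable [MeasurableSpace Z] {P : Kernel Z Z} [IsMarkovKernel P] {β c : ℝ} {V : Z → ℝ≥0∞} {K : ℝ≥0∞}
  {f r v : Z → ℝ}

namespace IsDriftWeight

lemma growth_ne_top {P : Kernel Z Z} (hV : IsDriftWeight P β V K) (hβ : 0 < β) : K ≠ ⊤ := by
  rintro rfl
  have h := hV.discount
  rw [ENNReal.mul_top (by simpa using hβ)] at h
  exact not_top_lt h

lemma lintegral_eval_le (hV : IsDriftWeight P β V K) (hf : ∀ z, ‖f z‖ₑ ≤ V z) (z : Z) (n : ℕ) :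
    ∫⁻ ω, ‖f (ω n)‖ₑ ∂(pathMeasure P z) ≤ K ^ n * V z :=
  (lintegral_mono fun _ => hf _).trans (lintegral_eval_le_of_drift hV.measurable hV.drift z n)

lemma integrable_eval (hV : IsDriftWeight P β V K) (hβ : 0 < β) (hfm : Measurable f)
    (hf : ∀ z, ‖f z‖ₑ ≤ V z) (z : Z) (n : ℕ) :
    Integrable (fun ω : ℕ → Z => f (ω n)) (pathMeasure P z) :=
  ⟨(hfm.comp (measurable_pi_apply n)).aestronglyMeasurable,
    (hV.lintegral_eval_le hf z n).trans_lt (ENNReal.mul_lt_top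
      (ENNReal.pow_lt_top (hV.growth_ne_top hβ).lt_top) (hV.ne_top z).lt_top)⟩

lemma integrable_increment (hV : IsDriftWeight P β V K) (hβ : 0 < β) (hfm : Measurable f)
    (hf : ∀ z, ‖f z‖ₑ ≤ V z) (z : Z) (j : ℕ) :
    Integrable (increment β c f j) (pathMeasure P z) :=
  ((((integrable_const c).add ((hV.integrable_eval hβ hfm hf z (j + 1)).const_mul β)).sub
    (hV.integrable_eval hβ hfm hf z j)).const_mul (β ^ j))

lemma tsum_lintegral_increment_ne_top (hV : IsDriftWeight P β V K) (hβ : 0 < β) (hβ1 : β < 1)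
    (hfm : Measurable f) (hf : ∀ z, ‖f z‖ₑ ≤ V z) (z : Z) :
    ∑' j, ∫⁻ ω, ‖increment β c f j ω‖ₑ ∂(pathMeasure P z) ≠ ⊤ := by
  set b := ENNReal.ofReal β with hb
  have hb1 : b < 1 := by rw [hb]; exact ENNReal.ofReal_lt_one.2 hβ1
  have hβb : ‖β‖ₑ = b := Real.enorm_of_nonneg hβ.le
  -- The flow part decays like β^j and the part coming from `f` like (βK)^j: two convergent
  -- geometric series.
  have key : ∀ j, ∫⁻ ω, ‖increment β c f j ω‖ₑ ∂(pathMeasure P z) ≤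
      ‖c‖ₑ * b ^ j + (b * K + 1) * V z * (b * K) ^ j := by
    intro j
    calc _ ≤ ∫⁻ ω, b ^ j * (‖c‖ₑ + b * ‖f (ω (j + 1))‖ₑ + ‖f (ω j)‖ₑ) ∂(pathMeasure P z) := by
          refine lintegral_mono fun ω => ?_
          simp only [increment]
          rw [enorm_mul, enorm_pow, hβb]
          gcongr
          refine (enorm_sub_le).trans ?_
          gcongr
          refine (enorm_add_le _ _).trans ?_
          rw [enorm_mul, hβb]
      _ = b ^ j * (‖c‖ₑ + b * ∫⁻ ω, ‖f (ω (j + 1))‖ₑ ∂(pathMeasure P z) +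
            ∫⁻ ω, ‖f (ω j)‖ₑ ∂(pathMeasure P z)) := by
          rw [lintegral_const_mul _ (by fun_prop), lintegral_add_left (by fun_prop),
            lintegral_add_left (by fun_prop), lintegral_const_mul _ (by fun_prop)]
          simp
      _ ≤ b ^ j * (‖c‖ₑ + b * (K ^ (j + 1) * V z) + K ^ j * V z) := by
          gcongr <;> exact hV.lintegral_eval_le hf z _
      _ = _ := by rw [mul_pow, pow_succ]; ring
  refine ne_top_of_le_ne_top ?_ (ENNReal.tsum_le_tsum key)
  rw [ENNReal.tsum_add, ENNReal.tsum_mul_left, ENNReal.tsum_mul_left, ENNReal.tsum_geometric,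
    ENNReal.tsum_geometric]
  have hbK := hV.discount
  refine ENNReal.add_ne_top.2 ⟨ENNReal.mul_ne_top enorm_ne_top ?_,
    ENNReal.mul_ne_top (ENNReal.mul_ne_top (ENNReal.add_ne_top.2
      ⟨hbK.ne_top, ENNReal.one_ne_top⟩) (hV.ne_top z)) ?_⟩
  · exact ENNReal.inv_ne_top.2 (tsub_pos_of_lt hb1).ne'
  · exact ENNReal.inv_ne_top.2 (tsub_pos_of_lt hbK).ne'

end IsDriftWeight

lemma measurableSet_lt_stoppingTime {z : Z} {τ : (ℕ → Z) → WithTop ℕ}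
    (hτ : IsFiniteStoppingTime P z τ) (j : ℕ) :
    MeasurableSet[Filtration.piLE (X := fun _ : ℕ => Z) j] {ω | (j : WithTop ℕ) < τ ω} :=
  hτ.1.measurableSet_gt j

lemma measurableSet_of_piLE {j : ℕ} {A : Set (ℕ → Z)}
    (hA : MeasurableSet[Filtration.piLE (X := fun _ : ℕ => Z) j] A) : MeasurableSet A :=
  (Filtration.piLE (X := fun _ : ℕ => Z)).le j _ hA

section

variable {z : Z} {τ : (ℕ → Z) → WithTop ℕ}

lemma tsum_lintegral_indicator_ne_top (hV : IsDriftWeight P β V K) (hβ : 0 < β) (hβ1 : β < 1)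
    (hfm : Measurable f) (hf : ∀ z, ‖f z‖ₑ ≤ V z) :
    ∑' j : ℕ, ∫⁻ ω, ‖{ω | (j : WithTop ℕ) < τ ω}.indicator (increment β c f j) ω‖ₑ
      ∂(pathMeasure P z) ≠ ⊤ :=
  ne_top_of_le_ne_top (hV.tsum_lintegral_increment_ne_top (c := c) hβ hβ1 hfm hf z)
    (ENNReal.tsum_le_tsum fun _ => lintegral_mono fun _ => enorm_indicator_le_enorm_self _ _)

lemma aestronglyMeasurable_indicator_increment (hV : IsDriftWeight P β V K) (hβ : 0 < β)
    (hfm : Measurable f) (hf : ∀ z, ‖f z‖ₑ ≤ V z) (hτ : IsFiniteStoppingTime P z τ) (j : ℕ) :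
    AEStronglyMeasurable ({ω | (j : WithTop ℕ) < τ ω}.indicator (increment β c f j))
      (pathMeasure P z) :=
  (hV.integrable_increment hβ hfm hf z j).aestronglyMeasurable.indicator
    (measurableSet_of_piLE (measurableSet_lt_stoppingTime hτ j))

/-- Where τ = ⊤ the payoff is read at the default date 0 and need not agree with the series; this
set is null. -/
lemma payoff_ae_eq_tsum (hτ : IsFiniteStoppingTime P z τ) :
    payoff β f (fun _ => c) τ =ᵐ[pathMeasure P z] fun ω =>
      f (ω 0) + ∑' j : ℕ, {ω | (j : WithTop ℕ) < τ ω}.indicator (increment β c f j) ω := by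
  filter_upwards [hτ.2] with ω hω using payoff_eq_tsum β c f hω

lemma integrable_tsum_increment (hV : IsDriftWeight P β V K) (hβ : 0 < β) (hβ1 : β < 1)
    (hfm : Measurable f) (hf : ∀ z, ‖f z‖ₑ ≤ V z) (hτ : IsFiniteStoppingTime P z τ) :
    Integrable (fun ω => ∑' j : ℕ,
      {ω | (j : WithTop ℕ) < τ ω}.indicator (increment β c f j) ω) (pathMeasure P z) := by
  have hm : ∀ j : ℕ, Measurable ({ω | (j : WithTop ℕ) < τ ω}.indicator (increment β c f j)) :=
    fun j => Measurable.indicator (by unfold increment; fun_prop)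
      (measurableSet_of_piLE (measurableSet_lt_stoppingTime hτ j))
  have hfin := tsum_lintegral_indicator_ne_top (z := z) (τ := τ) (c := c) hV hβ hβ1 hfm hf
  refine ⟨(Measurable.tsum hm).aestronglyMeasurable, ?_⟩
  refine lt_of_le_of_lt (lintegral_mono fun ω => ?_)
    ((lintegral_tsum fun j => (hm j).enorm.aemeasurable).trans_lt hfin.lt_top)
  exact enorm_tsum_le_tsum_enorm

lemma integrable_payoff (hV : IsDriftWeight P β V K) (hβ : 0 < β) (hβ1 : β < 1)
    (hfm : Measurable f) (hf : ∀ z, ‖f z‖ₑ ≤ V z) (hτ : IsFiniteStoppingTime P z τ) :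
    Integrable (payoff β f (fun _ => c) τ) (pathMeasure P z) :=
  (integrable_congr (payoff_ae_eq_tsum hτ)).2 ((hV.integrable_eval hβ hfm hf z 0).add
    (integrable_tsum_increment hV hβ hβ1 hfm hf hτ))

/-- Since {j < τ} is known at time j, f(Z_{j+1}) may be replaced on it by Pf(Z_j). The sign of c +
βPf - f then decides whether waiting pays. -/
lemma integral_payoff (hV : IsDriftWeight P β V K) (hβ : 0 < β) (hβ1 : β < 1)
    (hfm : Measurable f) (hf : ∀ z, ‖f z‖ₑ ≤ V z) (hτ : IsFiniteStoppingTime P z τ) :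
    ∫ ω, payoff β f (fun _ => c) τ ω ∂(pathMeasure P z) =
      f z + ∑' j : ℕ, ∫ ω in {ω | (j : WithTop ℕ) < τ ω},
        β ^ j * (c + β * (∫ y, f y ∂(P (ω j))) - f (ω j)) ∂(pathMeasure P z) := by
  rw [integral_congr_ae (payoff_ae_eq_tsum hτ),
    integral_add (hV.integrable_eval hβ hfm hf z 0)
      (integrable_tsum_increment hV hβ hβ1 hfm hf hτ), integral_eval_zero hfm,
    integral_tsum (aestronglyMeasurable_indicator_increment hV hβ hfm hf hτ)
      (tsum_lintegral_indicator_ne_top hV hβ hβ1 hfm hf)]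
  congr 2
  funext j
  have hA := measurableSet_lt_stoppingTime hτ j
  have hi := hV.integrable_eval hβ hfm hf z
  have hPi : Integrable (fun ω : ℕ → Z => ∫ y, f y ∂(P (ω j))) (pathMeasure P z) := by
    refine ⟨((hfm.stronglyMeasurable.integral_kernel (κ := P)).comp_measurable
      (measurable_pi_apply j)).aestronglyMeasurable, ?_⟩
    refine lt_of_le_of_lt (lintegral_mono fun ω => enorm_integral_le_lintegral_enorm _) ?_
    rw [← lintegral_eval_succ hfm.enorm]
    exact (hi (j + 1)).2
  rw [integral_indicator (measurableSet_of_piLE hA)]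
  simp only [increment]
  rw [integral_const_mul, integral_const_mul, integral_sub, integral_add, integral_const_mul,
    setIntegral_eval_succ hfm hA (hi _), integral_sub, integral_add, integral_const_mul]
  · exact (integrable_const c).integrableOn
  · exact (hPi.const_mul β).integrableOn
  · exact ((integrable_const c).add (hPi.const_mul β)).integrableOn
  · exact (hi j).integrableOn
  · exact (integrable_const c).integrableOn
  · exact ((hi _).const_mul β).integrableOn
  · exact ((integrable_const c).add ((hi _).const_mul β)).integrableOn
  · exact (hi j).integrableOn

/-- Payoffs are dominated by any excessive majorant of the exit payoff. -/
lemma integral_payoff_le (hV : IsDriftWeight P β V K) (hβ : 0 < β) (hβ1 : β < 1)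
    (hrm : Measurable r) (hr : ∀ z, ‖r z‖ₑ ≤ V z) (hvm : Measurable v) (hv : ∀ z, ‖v z‖ₑ ≤ V z)
    (hrv : ∀ z, r z ≤ v z) (hPv : ∀ z, c + β * ∫ y, v y ∂(P z) ≤ v z)
    (hτ : IsFiniteStoppingTime P z τ) :
    ∫ ω, payoff β r (fun _ => c) τ ω ∂(pathMeasure P z) ≤ v z := by
  calc _ ≤ ∫ ω, payoff β v (fun _ => c) τ ω ∂(pathMeasure P z) :=
        integral_mono (integrable_payoff hV hβ hβ1 hrm hr hτ)
          (integrable_payoff hV hβ hβ1 hvm hv hτ) fun ω => by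
            unfold payoff
            have := hrv (ω ((τ ω).untopD 0))
            gcongr
    _ ≤ v z := by
        rw [integral_payoff hV hβ hβ1 hvm hv hτ, add_le_iff_nonpos_right]
        refine tsum_nonpos fun j => integral_nonpos fun ω => ?_
        exact mul_nonpos_of_nonneg_of_nonpos (by positivity) (by linarith [hPv (ω j)])

/-- A stopping time attains the majorant if it waits only where waiting is fair and stops only
where the majorant equals the exit payoff. -/
lemma integral_payoff_eq (hV : IsDriftWeight P β V K) (hβ : 0 < β) (hβ1 : β < 1)
    (hvm : Measurable v) (hv : ∀ z, ‖v z‖ₑ ≤ V z)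
    (hτ : IsFiniteStoppingTime P z τ)
    (hcont : ∀ (ω : ℕ → Z) (j : ℕ), (j : WithTop ℕ) < τ ω →
      c + β * ∫ y, v y ∂(P (ω j)) = v (ω j))
    (hexit : ∀ (ω : ℕ → Z) (j : ℕ), τ ω = j → r (ω j) = v (ω j)) :
    ∫ ω, payoff β r (fun _ => c) τ ω ∂(pathMeasure P z) = v z := by
  have h : payoff β r (fun _ => c) τ =ᵐ[pathMeasure P z] payoff β v (fun _ => c) τ := by
    filter_upwards [hτ.2] with ω hω
    obtain ⟨n, hn⟩ := WithTop.ne_top_iff_exists.1 hω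
    rw [payoff, payoff, ← hn, WithTop.untopD_coe, hexit ω n hn.symm]
  rw [integral_congr_ae h, integral_payoff hV hβ hβ1 hvm hv hτ]
  simp only [add_eq_left]
  refine (tsum_congr fun j => ?_).trans tsum_zero
  refine setIntegral_eq_zero_of_forall_eq_zero fun ω hω => ?_
  rw [hcont ω j hω, sub_self, mul_zero]

end

/-- Verification theorem: well-definedness of the value function. -/
lemma valueWellDefined_of_excessive (hV : IsDriftWeight P β V K) (hβ : 0 < β) (hβ1 : β < 1)
    (hrm : Measurable r) (hr : ∀ z, ‖r z‖ₑ ≤ V z) (hvm : Measurable v) (hv : ∀ z, ‖v z‖ₑ ≤ V z)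
    (hrv : ∀ z, r z ≤ v z) (hPv : ∀ z, c + β * ∫ y, v y ∂(P z) ≤ v z) :
    ValueWellDefined P β r (fun _ => c) := by
  refine fun z => ⟨fun τ hτ => integrable_payoff hV hβ hβ1 hrm hr hτ, v z, ?_⟩
  rintro _ ⟨τ, rfl⟩
  exact integral_payoff_le hV hβ hβ1 hrm hr hvm hv hrv hPv τ.2

/-- Verification theorem: identification of the value function and of an optimal policy. -/
lemma value_eq_and_isOptimalPolicy (hV : IsDriftWeight P β V K) (hβ : 0 < β) (hβ1 : β < 1)
    (hrm : Measurable r) (hr : ∀ z, ‖r z‖ₑ ≤ V z) (hvm : Measurable v) (hv : ∀ z, ‖v z‖ₑ ≤ V z)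
    (hrv : ∀ z, r z ≤ v z) (hPv : ∀ z, c + β * ∫ y, v y ∂(P z) ≤ v z)
    {S : Set Z} (hS : ∀ z, IsFiniteStoppingTime P z
      (hittingAfter (fun (t : ℕ) (ω : ℕ → Z) => ω t) S 0))
    (hmem : ∀ z ∈ S, r z = v z) (hnot : ∀ z ∉ S, c + β * ∫ y, v y ∂(P z) = v z) :
    (∀ z, value P β r (fun _ => c) z = v z) ∧ IsOptimalPolicy P β r (fun _ => c) S := by
  have hwd := valueWellDefined_of_excessive hV hβ hβ1 hrm hr hvm hv hrv hPv
  have hatt : ∀ z, ∫ ω, payoff β r (fun _ => c)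
      (hittingAfter (fun (t : ℕ) (ω : ℕ → Z) => ω t) S 0) ω ∂(pathMeasure P z) = v z := by
    refine fun z => integral_payoff_eq hV hβ hβ1 hvm hv (hS z) (fun ω j hj => ?_)
      (fun ω j hj => ?_)
    · exact hnot _ (notMem_of_lt_hittingAfter (u := fun (t : ℕ) (ω : ℕ → Z) => ω t) hj
        (Nat.zero_le j))
    · have h := hittingAfter_mem_set_of_ne_top (u := fun (t : ℕ) (ω : ℕ → Z) => ω t) (s := S)
        (n := 0) (ω := ω) (by rw [hj]; exact WithTop.coe_ne_top)
      rw [hj] at h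
      exact hmem _ (by rwa [show (j : WithTop ℕ).untopA = j from rfl] at h)
  have hval : ∀ z, value P β r (fun _ => c) z = v z := by
    intro z
    have : Nonempty {τ : (ℕ → Z) → WithTop ℕ // IsFiniteStoppingTime P z τ} := ⟨⟨_, hS z⟩⟩
    refine le_antisymm (ciSup_le fun τ => integral_payoff_le hV hβ hβ1 hrm hr hvm hv hrv hPv τ.2) ?_
    rw [← hatt z]
    exact le_ciSup (hwd z).2 ⟨_, hS z⟩
  exact ⟨hval, fun z => ⟨hS z, (hatt z).trans (hval z).symm⟩⟩

end Verification

/-! ### Almost sure finiteness of hitting times. -/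

section Recurrence

variable {Z : Type} [MeasurableSpace Z] {P : Kernel Z Z} [IsMarkovKernel P] {S : Set Z}

lemma isStoppingTime_hitting (hS : MeasurableSet S) :
    IsStoppingTime (Filtration.piLE (X := fun _ : ℕ => Z))
      (hittingAfter (fun (t : ℕ) (ω : ℕ → Z) => ω t) S 0) := by
  refine Adapted.isStoppingTime_hittingAfter (fun j => ?_) hS
  rw [Filtration.piLE_eq_comap_frestrictLe]
  exact (measurable_pi_apply (⟨j, Finset.mem_Iic.2 le_rfl⟩ : Finset.Iic j)).comp
    (comap_measurable (frestrictLe (π := fun _ => Z) j))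

/-- The first hitting time of `S` is almost surely finite if the process is tight and enters `S`
with uniformly positive probability from suitable sets carrying most of the mass. -/
lemma isFiniteStoppingTime_hitting (hS : MeasurableSet S) (z : Z)
    (h : ∀ q : ℝ≥0∞, 0 < q → ∃ A : Set Z, MeasurableSet A ∧
      (∀ t, pathMeasure P z {ω | ω t ∉ A} ≤ q) ∧ ∃ ε : ℝ≥0∞, 0 < ε ∧ ∀ y ∈ A, ε ≤ P y S) :
    IsFiniteStoppingTime P z (hittingAfter (fun (t : ℕ) (ω : ℕ → Z) => ω t) S 0) := by
  set τ := hittingAfter (fun (t : ℕ) (ω : ℕ → Z) => ω t) S 0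
  have hst : IsStoppingTime (Filtration.piLE (X := fun _ : ℕ => Z)) τ := isStoppingTime_hitting hS
  refine ⟨hst, ?_⟩
  set μ := pathMeasure P z
  have hlt : ∀ j : ℕ, MeasurableSet[Filtration.piLE (X := fun _ : ℕ => Z) j]
      {ω | (j : WithTop ℕ) < τ ω} := fun j => hst.measurableSet_gt j
  rw [ae_iff]
  simp only [ne_eq, not_not]
  by_contra hne
  set p := μ {ω | τ ω = ⊤} with hp
  have hptop : p ≠ ⊤ := measure_ne_top _ _
  -- Let p > 0 be the probability of never entering. With escape probability p/2 from `A`, at every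
  -- date t the process is still waiting and inside `A` with probability at least p/2. Hence P(τ =
  -- t+1) ≥ εp/2 for all t, and these disjoint events would have infinite total mass.
  obtain ⟨A, hA, hAq, ε, hε, hAε⟩ := h (p / 2) (ENNReal.half_pos hne)
  have step : ∀ t : ℕ, ε * (p / 2) ≤ μ {ω | τ ω = (t + 1 : ℕ)} := by
    intro t
    have h1 : p ≤ μ ({ω | (t : WithTop ℕ) < τ ω} ∩ {ω | ω t ∈ A}) + p / 2 := by
      refine le_trans (measure_mono (t := ({ω | (t : WithTop ℕ) < τ ω} ∩ {ω | ω t ∈ A}) ∪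
        {ω | ω t ∉ A}) fun ω hω => ?_) ((measure_union_le _ _).trans (by gcongr; exact hAq t))
      by_cases hωA : ω t ∈ A
      · left
        refine ⟨?_, hωA⟩
        rw [mem_ofPred_eq] at hω ⊢
        rw [hω]
        exact WithTop.coe_lt_top t
      · exact Or.inr hωA
    have h2 : p / 2 ≤ μ ({ω | (t : WithTop ℕ) < τ ω} ∩ {ω | ω t ∈ A}) := by
      have : p / 2 + p / 2 ≤ μ ({ω | (t : WithTop ℕ) < τ ω} ∩ {ω | ω t ∈ A}) + p / 2 := by
        rwa [ENNReal.add_halves]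
      exact (ENNReal.add_le_add_iff_right (ENNReal.div_ne_top hptop two_ne_zero)).1 this
    have hmA : MeasurableSet {ω : ℕ → Z | ω t ∈ A} := (measurable_pi_apply t) hA
    calc ε * (p / 2) ≤ ε * μ ({ω | (t : WithTop ℕ) < τ ω} ∩ {ω | ω t ∈ A}) := by gcongr
      _ = ∫⁻ ω in {ω | (t : WithTop ℕ) < τ ω} ∩ {ω | ω t ∈ A}, ε ∂μ := by
          rw [setLIntegral_const]
      _ ≤ ∫⁻ ω in {ω | (t : WithTop ℕ) < τ ω} ∩ {ω | ω t ∈ A}, P (ω t) S ∂μ :=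
          setLIntegral_mono' ((measurableSet_of_piLE (hlt t)).inter hmA) fun ω hω => hAε _ hω.2
      _ ≤ ∫⁻ ω in {ω | (t : WithTop ℕ) < τ ω}, P (ω t) S ∂μ :=
          lintegral_mono_set inter_subset_left
      _ = ∫⁻ ω in {ω | (t : WithTop ℕ) < τ ω}, S.indicator 1 (ω (t + 1)) ∂μ := by
          rw [setLIntegral_eval_succ (measurable_one.indicator hS) (hlt t)]
          simp only [lintegral_indicator_one hS]
          rfl
      _ = μ ((fun ω : ℕ → Z => ω (t + 1)) ⁻¹' S ∩ {ω | (t : WithTop ℕ) < τ ω}) := by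
          have : ∀ ω : ℕ → Z, S.indicator (1 : Z → ℝ≥0∞) (ω (t + 1)) =
              ((fun ω : ℕ → Z => ω (t + 1)) ⁻¹' S).indicator 1 ω := fun ω => rfl
          simp only [this]
          rw [lintegral_indicator_one ((measurable_pi_apply (t + 1)) hS),
            Measure.restrict_apply ((measurable_pi_apply (t + 1)) hS)]
      _ ≤ μ {ω | τ ω = (t + 1 : ℕ)} := by
          refine measure_mono fun ω hω => ?_
          refine le_antisymm (hittingAfter_le_of_mem (Nat.zero_le _) hω.1) ?_
          have h3 : (t : WithTop ℕ) < τ ω := hω.2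
          rcases eq_or_ne (τ ω) ⊤ with h4 | h4
          · rw [h4]; exact le_top
          · obtain ⟨n, hn⟩ := WithTop.ne_top_iff_exists.1 h4
            rw [← hn] at h3 ⊢
            -- In ℕ, t < n is by definition t + 1 ≤ n.
            exact WithTop.coe_le_coe.2 (WithTop.coe_lt_coe.1 h3)
  have hsum : ∑' t : ℕ, μ {ω | τ ω = (t + 1 : ℕ)} ≤ 1 := by
    rw [← measure_iUnion]
    · exact prob_le_one
    · intro s t hst'
      refine disjoint_left.2 fun ω h1 h2 => hst' ?_
      rw [mem_ofPred_eq] at h1 h2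
      rw [h1] at h2
      exact Nat.succ_injective (WithTop.coe_injective h2)
    · intro t
      exact (Filtration.piLE (X := fun _ : ℕ => Z)).le _ _ (hst.measurableSet_eq (t + 1))
  have hinf : ∑' _ : ℕ, ε * (p / 2) = ⊤ :=
    ENNReal.tsum_const_eq_top_of_ne_zero (mul_ne_zero hε.ne' (ENNReal.half_pos hne).ne')
  exact absurd ((hinf.ge.trans (ENNReal.tsum_le_tsum step)).trans hsum) (by simp)

end Recurrence

end OptStop

/-! ### Lognormal moments and inequalities for powers. -/

lemma measurable_posReal_rpow (p : ℝ) : Measurable fun x : PosReal => (x : ℝ) ^ p := by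
  fun_prop

lemma posReal_pos (x : PosReal) : 0 < (x : ℝ) := x.2

lemma integrable_rpow_logNormal (μ : ℝ) (γ : ℝ≥0) (p : ℝ) :
    Integrable (fun x : PosReal => (x : ℝ) ^ p) (logNormal μ γ) := by
  rw [logNormal, integrable_map_measure (measurable_posReal_rpow p).aestronglyMeasurable
    measurable_posExp.aemeasurable]
  have h : ((fun x : PosReal => (x : ℝ) ^ p) ∘
      fun x : ℝ => (⟨Real.exp x, Real.exp_pos x⟩ : PosReal)) = fun x => Real.exp (p * x) := by
    funext x
    simp [← Real.exp_mul, mul_comm]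
  rw [h]
  exact integrable_exp_mul_gaussianReal p

lemma integral_rpow_logNormal (μ : ℝ) (γ : ℝ≥0) (p : ℝ) :
    ∫ x : PosReal, (x : ℝ) ^ p ∂(logNormal μ γ) = Real.exp (μ * p + γ * p ^ 2 / 2) := by
  rw [logNormal, integral_map measurable_posExp.aemeasurable
    (measurable_posReal_rpow p).aestronglyMeasurable]
  have h := congrFun (mgf_fun_id_gaussianReal (μ := μ) (v := γ)) p
  rw [← h, mgf]
  refine integral_congr_ae (ae_of_all _ fun x => ?_)
  simp [← Real.exp_mul, mul_comm]

/-- `x^q + x^{-q}` is increasing in `|q|`. -/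
lemma rpow_add_rpow_neg_le {x p q : ℝ} (hx : 0 < x) (h : |q| ≤ |p|) :
    x ^ q + x ^ (-q) ≤ x ^ p + x ^ (-p) := by
  have key : ∀ t : ℝ, x ^ t + x ^ (-t) = 2 * Real.cosh (Real.log x * t) := by
    intro t
    rw [Real.rpow_def_of_pos hx, Real.rpow_def_of_pos hx, Real.cosh_eq, mul_neg]
    ring
  rw [key, key]
  have : Real.cosh (Real.log x * q) ≤ Real.cosh (Real.log x * p) := by
    rw [Real.cosh_le_cosh, abs_mul, abs_mul]
    gcongr
  linarith

/-- A power with exponent at most one is dominated by the sum of the powers. -/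
lemma rpow_add_le_of_le_one {x y p : ℝ} (hx : 0 < x) (hy : 0 < y) (hp : p ≤ 1) :
    (x + y) ^ p ≤ x ^ p + y ^ p := by
  rcases le_or_gt 0 p with h | h
  · exact Real.rpow_add_le_add_rpow hx.le hy.le h hp
  · have h1 : (x + y) ^ p ≤ x ^ p := Real.rpow_le_rpow_of_nonpos hx (by linarith) h.le
    have h2 : 0 < y ^ p := Real.rpow_pos_of_pos hy p
    linarith

/-! ### Moments of the state, and the weight functions. -/

namespace JobSearch

variable (M : JobSearch)

lemma measurable_r : Measurable M.r := by
  unfold r crra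
  split_ifs <;> fun_prop

lemma r_eq (hδ1 : M.δ ≠ 1) (w : PosReal) :
    M.r w = (w : ℝ) ^ (1 - M.δ) / ((1 - M.β) * (1 - M.δ)) := by
  rw [r, crra, if_neg hδ1, div_div, mul_comm]

lemma abs_r_eq (hβ1 : M.β < 1) (hδ1 : M.δ ≠ 1) (w : PosReal) :
    |M.r w| = (w : ℝ) ^ (1 - M.δ) / ((1 - M.β) * |1 - M.δ|) := by
  rw [M.r_eq hδ1, abs_div, abs_mul, abs_of_pos (Real.rpow_pos_of_pos w.2 _),
    abs_of_pos (sub_pos.2 hβ1)]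

lemma measurable_next_right (θ : PosReal) : Measurable (M.next θ) :=
  M.measurable_next.comp measurable_prodMk_left

lemma integrable_thetaKernel_iff {f : PosReal × PosReal → ℝ} (hf : Measurable f) (θ : PosReal) :
    Integrable f (M.thetaKernel θ) ↔ Integrable (fun s => f (M.next θ s)) M.shockLaw :=
  integrable_map_measure hf.aestronglyMeasurable (M.measurable_next_right θ).aemeasurable

lemma integral_thetaKernel {f : PosReal × PosReal → ℝ} (hf : Measurable f) (θ : PosReal) :
    ∫ z, f z ∂(M.thetaKernel θ) = ∫ s, f (M.next θ s) ∂M.shockLaw :=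
  integral_map (M.measurable_next_right θ).aemeasurable hf.aestronglyMeasurable

lemma integrable_shock_rpow (p q t : ℝ) :
    Integrable (fun s : PosReal × PosReal × PosReal =>
      (s.1 : ℝ) ^ p * ((s.2.1 : ℝ) ^ q * (s.2.2 : ℝ) ^ t)) M.shockLaw :=
  (integrable_rpow_logNormal _ _ p).mul_prod
    ((integrable_rpow_logNormal _ _ q).mul_prod (integrable_rpow_logNormal _ _ t))

lemma nextTheta_rpow (θ u : PosReal) (p : ℝ) :
    (M.nextTheta θ u : ℝ) ^ p = (θ : ℝ) ^ (p * M.ρ) * (u : ℝ) ^ p := by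
  rw [nextTheta, Real.mul_rpow (Real.rpow_nonneg (posReal_pos θ).le _) (posReal_pos u).le,
    ← Real.rpow_mul (posReal_pos θ).le, mul_comm p]

/-- Moments of the persistent state one period ahead. -/
lemma integrable_theta_rpow (θ : PosReal) (p : ℝ) :
    Integrable (fun z : PosReal × PosReal => (z.2 : ℝ) ^ p) (M.thetaKernel θ) := by
  rw [M.integrable_thetaKernel_iff (by fun_prop)]
  simp only [next, M.nextTheta_rpow]
  simpa using (M.integrable_shock_rpow p 0 0).const_mul ((θ : ℝ) ^ (p * M.ρ))

lemma integral_theta_rpow (θ : PosReal) (p : ℝ) :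
    ∫ z, (z.2 : ℝ) ^ p ∂(M.thetaKernel θ) =
      Real.exp (M.γu * p ^ 2 / 2) * (θ : ℝ) ^ (p * M.ρ) := by
  rw [M.integral_thetaKernel (by fun_prop)]
  simp only [next, M.nextTheta_rpow]
  rw [integral_const_mul, shockLaw]
  have h := integral_prod_mul (μ := logNormal 0 M.γu)
    (ν := (logNormal 0 M.γξ).prod (logNormal M.μη M.γη))
    (fun u : PosReal => (u : ℝ) ^ p) (fun _ => (1 : ℝ))
  simp only [mul_one, integral_const, smul_eq_mul] at h
  rw [h, integral_rpow_logNormal]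
  simp [mul_comm]

/-- The bound on the exit payoff in terms of the shocks. -/
lemma abs_r_next_le (hβ1 : M.β < 1) (hδ0 : 0 ≤ M.δ) (hδ1 : M.δ ≠ 1) (θ : PosReal)
    (s : PosReal × PosReal × PosReal) :
    |M.r (M.next θ s).1| ≤ ((s.2.2 : ℝ) ^ (1 - M.δ) + (θ : ℝ) ^ ((1 - M.δ) * M.ρ) *
      ((s.1 : ℝ) ^ (1 - M.δ) * (s.2.1 : ℝ) ^ (1 - M.δ))) / ((1 - M.β) * |1 - M.δ|) := by
  have h1 : 0 < 1 - M.β := sub_pos.2 hβ1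
  rw [M.abs_r_eq hβ1 hδ1]
  refine div_le_div_of_nonneg_right ?_ (by positivity)
  -- Here δ ≥ 0 enters: the exponent 1 - δ is at most 1, possibly negative.
  have h2 := rpow_add_le_of_le_one (x := (s.2.2 : ℝ)) (y := (M.nextTheta θ s.1 : ℝ) * (s.2.1 : ℝ))
    (p := 1 - M.δ) s.2.2.2 (mul_pos (posReal_pos _) (posReal_pos _)) (by linarith)
  refine h2.trans (le_of_eq ?_)
  rw [Real.mul_rpow (posReal_pos _).le (posReal_pos _).le, nextTheta_rpow, mul_assoc]

/-- The current state enters the shock bound only through the factor θ^{(1-δ)ρ}; all moments of the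
shocks are finite, and `A`, `B` are such moments up to normalization. -/
lemma exit_bound (hβ1 : M.β < 1) (hδ0 : 0 ≤ M.δ) (hδ1 : M.δ ≠ 1) :
    ∃ A B : ℝ, 0 ≤ A ∧ 0 ≤ B ∧ ∀ θ,
      Integrable (fun z : PosReal × PosReal => M.r z.1) (M.thetaKernel θ) ∧
      ∫ z, |M.r z.1| ∂(M.thetaKernel θ) ≤ A + B * (θ : ℝ) ^ ((1 - M.δ) * M.ρ) := by
  have h1 : 0 < 1 - M.β := sub_pos.2 hβ1
  set R := (1 - M.β) * |1 - M.δ| with hR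
  have hR0 : 0 ≤ R := by positivity
  set f : PosReal × PosReal × PosReal → ℝ := fun s => (s.2.2 : ℝ) ^ (1 - M.δ) with hf
  set g : PosReal × PosReal × PosReal → ℝ :=
    fun s => (s.1 : ℝ) ^ (1 - M.δ) * (s.2.1 : ℝ) ^ (1 - M.δ) with hg
  have hfi : Integrable f M.shockLaw := by
    simpa using M.integrable_shock_rpow 0 0 (1 - M.δ)
  have hgi : Integrable g M.shockLaw := by
    simpa using M.integrable_shock_rpow (1 - M.δ) (1 - M.δ) 0
  have hf0 : ∀ s, 0 ≤ f s := fun s => Real.rpow_nonneg (posReal_pos _).le _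
  have hg0 : ∀ s, 0 ≤ g s := fun s =>
    mul_nonneg (Real.rpow_nonneg (posReal_pos _).le _) (Real.rpow_nonneg (posReal_pos _).le _)
  have hbd : ∀ θ : PosReal, Integrable
      (fun s => (f s + (θ : ℝ) ^ ((1 - M.δ) * M.ρ) * g s) / R) M.shockLaw :=
    fun θ => (hfi.add (hgi.const_mul _)).div_const R
  have hrm : Measurable fun z : PosReal × PosReal => M.r z.1 := M.measurable_r.comp measurable_fst
  have hint : ∀ θ, Integrable (fun s => M.r (M.next θ s).1) M.shockLaw := fun θ =>
    (hbd θ).mono' (hrm.comp (M.measurable_next_right θ)).aestronglyMeasurable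
      (ae_of_all _ fun s => M.abs_r_next_le hβ1 hδ0 hδ1 θ s)
  refine ⟨(∫ s, f s ∂M.shockLaw) / R, (∫ s, g s ∂M.shockLaw) / R,
    div_nonneg (integral_nonneg hf0) hR0, div_nonneg (integral_nonneg hg0) hR0, fun θ => ⟨?_, ?_⟩⟩
  · rw [M.integrable_thetaKernel_iff hrm]
    exact hint θ
  · rw [M.integral_thetaKernel (f := fun z => |M.r z.1|) hrm.abs]
    refine (integral_mono (hint θ).abs (hbd θ)
      (fun s => M.abs_r_next_le hβ1 hδ0 hδ1 θ s)).trans (le_of_eq ?_)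
    rw [integral_div, integral_add hfi (hgi.const_mul _), integral_const_mul]
    ring

instance (k : ℕ) : IsMarkovKernel (M.stateLaw k) := by
  induction k with
  | zero => unfold stateLaw; infer_instance
  | succ k ih => unfold stateLaw; infer_instance

lemma stateLaw_succ (k : ℕ) : M.stateLaw (k + 1) = M.kernel ∘ₖ M.stateLaw k := rfl

/-- First-step decomposition of the laws of the state. -/
lemma stateLaw_succ' (k : ℕ) :
    M.stateLaw (k + 1) = (M.stateLaw k).comap Prod.snd measurable_snd ∘ₖ M.thetaKernel := by
  induction k with
  | zero => rfl
  | succ k ih =>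
    conv_lhs => rw [stateLaw_succ, ih, ← Kernel.comp_assoc]
    rfl

lemma kernel_apply (z : PosReal × PosReal) : M.kernel z = M.thetaKernel z.2 := rfl

/-- Each transition multiplies the exponent by ρ and contributes a lognormal moment. The exponent is
quantified inside the induction because the step for p uses the claim for pρ. -/
lemma stateLaw_theta_rpow (k : ℕ) : ∀ p : ℝ, ∃ C : ℝ, 0 < C ∧ ∀ θ,
    Integrable (fun z : PosReal × PosReal => (z.2 : ℝ) ^ p) (M.stateLaw k θ) ∧
    ∫ z, (z.2 : ℝ) ^ p ∂(M.stateLaw k θ) = C * (θ : ℝ) ^ (p * M.ρ ^ (k + 1)) := by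
  induction k with
  | zero =>
    intro p
    refine ⟨Real.exp (M.γu * p ^ 2 / 2), Real.exp_pos _, fun θ => ⟨M.integrable_theta_rpow θ p, ?_⟩⟩
    simpa [stateLaw] using M.integral_theta_rpow θ p
  | succ k ih =>
    intro p
    obtain ⟨C, hC, h⟩ := ih (p * M.ρ)
    have hnorm : ∀ z : PosReal × PosReal, ‖(z.2 : ℝ) ^ p‖ = (z.2 : ℝ) ^ p := fun z =>
      Real.norm_of_nonneg (Real.rpow_nonneg (posReal_pos _).le _)
    have hi : ∀ θ, Integrable (fun z : PosReal × PosReal => (z.2 : ℝ) ^ p)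
        (M.stateLaw (k + 1) θ) := by
      intro θ
      have hm : Measurable fun z : PosReal × PosReal => (z.2 : ℝ) ^ p := by fun_prop
      rw [stateLaw_succ, integrable_comp_iff hm.aestronglyMeasurable]
      refine ⟨ae_of_all _ fun y => M.integrable_theta_rpow y.2 p, ?_⟩
      simp only [hnorm, kernel_apply, integral_theta_rpow]
      exact (h θ).1.const_mul _
    refine ⟨Real.exp (M.γu * p ^ 2 / 2) * C, by positivity, fun θ => ⟨hi θ, ?_⟩⟩
    have hi' := hi θ
    rw [stateLaw_succ] at hi' ⊢
    rw [Kernel.integral_comp hi']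
    simp only [kernel_apply, integral_theta_rpow]
    rw [integral_const_mul, (h θ).2, pow_succ' M.ρ (k + 1), mul_assoc p, mul_assoc]

/-- Expected absolute exit payoffs are finite, with an explicit bound in the current state. -/
lemma absExit_bound (hβ1 : M.β < 1) (hδ0 : 0 ≤ M.δ) (hδ1 : M.δ ≠ 1) (k : ℕ) :
    ∃ A B : ℝ, 0 ≤ A ∧ 0 ≤ B ∧ ∀ θ,
      Integrable (fun z : PosReal × PosReal => M.r z.1) (M.stateLaw k θ) ∧
      M.absExit k θ ≤ A + B * (θ : ℝ) ^ ((1 - M.δ) * M.ρ ^ (k + 1)) := by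
  obtain ⟨A, B, hA, hB, h⟩ := M.exit_bound hβ1 hδ0 hδ1
  cases k with
  | zero => exact ⟨A, B, hA, hB, fun θ => by simpa [absExit, stateLaw] using h θ⟩
  | succ k =>
    obtain ⟨C, hC, hθ⟩ := M.stateLaw_theta_rpow k ((1 - M.δ) * M.ρ)
    have hrm : Measurable fun z : PosReal × PosReal => M.r z.1 :=
      M.measurable_r.comp measurable_fst
    have hbd : ∀ θ, Integrable (fun y : PosReal × PosReal =>
        A + B * (y.2 : ℝ) ^ ((1 - M.δ) * M.ρ)) (M.stateLaw k θ) := fun θ =>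
      (integrable_const A).add ((hθ θ).1.const_mul B)
    have hnn : ∀ y : PosReal × PosReal, 0 ≤ ∫ z, |M.r z.1| ∂(M.kernel y) := fun y =>
      integral_nonneg fun z => abs_nonneg _
    have hin : ∀ θ, Integrable (fun y => ∫ z, |M.r z.1| ∂(M.kernel y)) (M.stateLaw k θ) :=
      fun θ => (hbd θ).mono' (hrm.abs.stronglyMeasurable.integral_kernel.aestronglyMeasurable)
        (ae_of_all _ fun y => by
          rw [Real.norm_of_nonneg (hnn y)]
          exact (h y.2).2)
    have hi : ∀ θ, Integrable (fun z : PosReal × PosReal => M.r z.1)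
        (M.stateLaw (k + 1) θ) := by
      intro θ
      rw [stateLaw_succ, integrable_comp_iff hrm.aestronglyMeasurable]
      exact ⟨ae_of_all _ fun y => (h y.2).1, hin θ⟩
    refine ⟨A, B * C, hA, by positivity, fun θ => ⟨hi θ, ?_⟩⟩
    have hi' := (hi θ).abs
    rw [absExit]
    rw [stateLaw_succ] at hi' ⊢
    rw [Kernel.integral_comp hi']
    refine (integral_mono (hin θ) (hbd θ) fun y => (h y.2).2).trans (le_of_eq ?_)
    rw [integral_add (integrable_const A) ((hθ θ).1.const_mul B), integral_const_mul, (hθ θ).2,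
      pow_succ' M.ρ (k + 1)]
    simp [mul_assoc]

lemma absExit_nonneg (k : ℕ) (θ : PosReal) : 0 ≤ M.absExit k θ :=
  integral_nonneg fun _ => abs_nonneg _

lemma measurable_absExit (k : ℕ) : Measurable (M.absExit k) :=
  ((M.measurable_r.comp measurable_fst).abs.stronglyMeasurable.integral_kernel
    (κ := M.stateLaw k)).measurable

/-- This shift of dates is what makes the sum in ℓ telescope under the transition. -/
lemma absExit_succ (hβ1 : M.β < 1) (hδ0 : 0 ≤ M.δ) (hδ1 : M.δ ≠ 1) (k : ℕ) (θ : PosReal) :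
    Integrable (fun z : PosReal × PosReal => M.absExit k z.2) (M.thetaKernel θ) ∧
      ∫ z, M.absExit k z.2 ∂(M.thetaKernel θ) = M.absExit (k + 1) θ := by
  obtain ⟨A, B, hA, hB, h⟩ := M.absExit_bound hβ1 hδ0 hδ1 (k + 1)
  have hi := (h θ).1.abs
  rw [stateLaw_succ'] at hi
  refine ⟨?_, ?_⟩
  · have := ((integrable_comp_iff hi.1).1 hi).2
    simpa [absExit] using this
  · rw [absExit, stateLaw_succ', Kernel.integral_comp hi]
    rfl

lemma measurable_g (n : ℕ) : Measurable (M.g n) := by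
  unfold g; fun_prop

lemma g_pos (n : ℕ) (θ : PosReal) : 0 < M.g n θ :=
  add_pos (Real.rpow_pos_of_pos θ.2 _) (Real.rpow_pos_of_pos θ.2 _)

lemma one_le_m (n : ℕ) : 1 ≤ M.m n := by
  rw [m, Real.one_le_exp_iff, pow_mul']
  positivity

lemma integrable_g (n : ℕ) (θ : PosReal) :
    Integrable (fun z : PosReal × PosReal => M.g n z.2) (M.thetaKernel θ) :=
  (M.integrable_theta_rpow θ _).add (M.integrable_theta_rpow θ _)

/-- The drift of `g`. -/
lemma integral_g_le (hρ0 : -1 < M.ρ) (hρ1 : M.ρ < 1) (n : ℕ) (θ : PosReal) :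
    ∫ z, M.g n z.2 ∂(M.thetaKernel θ) ≤ M.m n * M.g n θ := by
  set p := (1 - M.δ) * M.ρ ^ n with hp
  have h1 : ∫ z, M.g n z.2 ∂(M.thetaKernel θ) =
      Real.exp (M.γu * p ^ 2 / 2) * ((θ : ℝ) ^ (p * M.ρ) + (θ : ℝ) ^ (-(p * M.ρ))) := by
    unfold g
    rw [integral_add (M.integrable_theta_rpow θ _) (M.integrable_theta_rpow θ _),
      integral_theta_rpow, integral_theta_rpow, ← hp, neg_sq, neg_mul]
    ring
  rw [h1]
  -- The transition shrinks the exponent from p to pρ, and a symmetrized power is monotone in the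
  -- absolute exponent; a single power would not be.
  have h2 : (θ : ℝ) ^ (p * M.ρ) + (θ : ℝ) ^ (-(p * M.ρ)) ≤ M.g n θ := by
    refine rpow_add_rpow_neg_le θ.2 ?_
    rw [abs_mul]
    exact mul_le_of_le_one_right (abs_nonneg _) (abs_le.2 ⟨hρ0.le, hρ1.le⟩)
  have h3 : Real.exp (M.γu * p ^ 2 / 2) ≤ M.m n := by
    rw [m, Real.exp_le_exp]
    have : M.ρ ^ (2 * n) * ((1 - M.δ) ^ 2 * (M.γu : ℝ)) = M.γu * p ^ 2 := by
      rw [hp, pow_mul']; ring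
    rw [this]
    have : 0 ≤ (M.γu : ℝ) * p ^ 2 := by positivity
    linarith
  have h4 : 0 ≤ (θ : ℝ) ^ (p * M.ρ) + (θ : ℝ) ^ (-(p * M.ρ)) :=
    add_nonneg (Real.rpow_nonneg (posReal_pos θ).le _) (Real.rpow_nonneg (posReal_pos θ).le _)
  exact mul_le_mul h3 h2 h4 ((Real.exp_pos _).le.trans h3)

/-- A weight function for the one-step transition of the model. -/
structure IsWeight (ℓ : PosReal → ℝ) (K C : ℝ) : Prop where
  measurable : Measurable ℓ
  pos : ∀ θ, 0 < ℓ θ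
  integrable : ∀ θ, Integrable (fun z : PosReal × PosReal => ℓ z.2) (M.thetaKernel θ)
  drift : ∀ θ, ∫ z, ℓ z.2 ∂(M.thetaKernel θ) ≤ K * ℓ θ
  growth_pos : 0 < K
  discount : M.β * K < 1
  const_nonneg : 0 ≤ C
  flow : ∀ θ, |M.c₀| ≤ C * ℓ θ
  exit_integrable : ∀ θ, Integrable (fun z : PosReal × PosReal => M.r z.1) (M.thetaKernel θ)
  exit : ∀ θ, ∫ z, |M.r z.1| ∂(M.thetaKernel θ) ≤ C * ℓ θ

variable {M}

lemma IsAdmissible.d'_le_ell {n : ℕ} {a b m' d' : ℝ} (h : M.IsAdmissible n a b m' d')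
    (θ : PosReal) : d' ≤ M.ell n a b m' d' θ := by
  have h1 : 0 ≤ ∑ k ∈ Finset.range (n - 1), M.absExit k θ :=
    Finset.sum_nonneg fun k _ => M.absExit_nonneg k θ
  have h2 := M.g_pos n θ
  have := h.a_pos
  have := h.b_nonneg
  have := h.m'_pos
  rw [ell]
  have : 0 ≤ m' * ((∑ k ∈ Finset.range (n - 1), M.absExit k θ) + n * |M.c₀|) +
    (a * M.g n θ + b) := by positivity
  linarith

lemma IsAdmissible.isWeight {n : ℕ} {a b m' d' : ℝ} (h : M.IsAdmissible n a b m' d')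
    (hβ1 : M.β < 1) (hδ0 : 0 ≤ M.δ) (hδ1 : M.δ ≠ 1) (hρ0 : -1 < M.ρ) (hρ1 : M.ρ < 1) :
    ∃ C, M.IsWeight (M.ell n a b m' d') (M.m n + 2 * m') C := by
  have hm' := h.m'_pos
  have hd' := h.d'_pos
  have ha := h.a_pos
  have hb := h.b_nonneg
  have hm1 := M.one_le_m n
  have hpos : ∀ θ, 0 < M.ell n a b m' d' θ := fun θ => hd'.trans_le (h.d'_le_ell θ)
  have hsi : ∀ θ, Integrable (fun z : PosReal × PosReal =>
      ∑ k ∈ Finset.range (n - 1), M.absExit k z.2) (M.thetaKernel θ) := fun θ =>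
    integrable_finsetSum _ fun k _ => (M.absExit_succ hβ1 hδ0 hδ1 k θ).1
  have hsum0 : ∀ θ, 0 ≤ ∑ k ∈ Finset.range (n - 1), M.absExit k θ := fun θ =>
    Finset.sum_nonneg fun k _ => M.absExit_nonneg k θ
  have hi1 : ∀ θ, Integrable (fun z : PosReal × PosReal =>
      m' * ((∑ k ∈ Finset.range (n - 1), M.absExit k z.2) + n * |M.c₀|)) (M.thetaKernel θ) :=
    fun θ => ((hsi θ).add (integrable_const _)).const_mul m'
  have hi2 : ∀ θ, Integrable (fun z : PosReal × PosReal => a * M.g n z.2 + b)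
      (M.thetaKernel θ) := fun θ => ((M.integrable_g n θ).const_mul a).add (integrable_const b)
  have hi12 : ∀ θ, Integrable (fun z : PosReal × PosReal =>
      m' * ((∑ k ∈ Finset.range (n - 1), M.absExit k z.2) + n * |M.c₀|) + (a * M.g n z.2 + b))
      (M.thetaKernel θ) := fun θ => (hi1 θ).add (hi2 θ)
  have hdrift : ∀ θ, ∫ z, M.ell n a b m' d' z.2 ∂(M.thetaKernel θ) ≤
      (M.m n + 2 * m') * M.ell n a b m' d' θ := by
    intro θ
    have heq : ∫ z, M.ell n a b m' d' z.2 ∂(M.thetaKernel θ) =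
        m' * ((∑ k ∈ Finset.range (n - 1), M.absExit (k + 1) θ) + n * |M.c₀|) +
          (a * ∫ z, M.g n z.2 ∂(M.thetaKernel θ)) + b + d' := by
      unfold ell
      rw [integral_add (hi12 θ) (integrable_const _), integral_add (hi1 θ) (hi2 θ),
        integral_const_mul, integral_add (hsi θ) (integrable_const _),
        integral_add ((M.integrable_g n θ).const_mul a) (integrable_const b),
        integral_const_mul,
        integral_finsetSum _ fun k _ => (M.absExit_succ hβ1 hδ0 hδ1 k θ).1]
      simp only [(M.absExit_succ hβ1 hδ0 hδ1 _ θ).2, integral_const, probReal_univ, smul_eq_mul,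
        one_mul]
      rw [integral_const_mul]
      ring
    -- For n ≥ 2 the shifted sum loses its first term and gains E_θ|r(w_n)|, which admissibility
    -- bounds by a g + b. For n ≤ 1 both sums are empty.
    have hS : ∑ k ∈ Finset.range (n - 1), M.absExit (k + 1) θ ≤
        (∑ k ∈ Finset.range (n - 1), M.absExit k θ) + (a * M.g n θ + b) := by
      have hg := M.g_pos n θ
      rcases lt_or_ge n 2 with hn | hn
      · have : n - 1 = 0 := by omega
        rw [this]
        simp only [Finset.range_zero, Finset.sum_empty]
        positivity
      · obtain ⟨k, rfl⟩ := Nat.exists_eq_add_of_le' hn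
        have e : k + 2 - 1 = k + 1 := rfl
        rw [e, Finset.sum_range_succ, Finset.sum_range_succ' (fun j => M.absExit j θ)]
        have := h.bound k rfl θ
        have := M.absExit_nonneg 0 θ
        linarith
    rw [heq, ell]
    have hg := M.integral_g_le hρ0 hρ1 n θ
    have hg0 := M.g_pos n θ
    have hs0 := hsum0 θ
    set S' := ∑ k ∈ Finset.range (n - 1), M.absExit (k + 1) θ
    set S := ∑ k ∈ Finset.range (n - 1), M.absExit k θ
    set G := M.g n θ
    set N := (n : ℝ) * |M.c₀| with hN
    have hN0 : 0 ≤ N := by positivity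
    have e1 : m' * (S' + N) ≤ m' * (S + (a * G + b) + N) := by gcongr
    have e2 : a * ∫ z, M.g n z.2 ∂(M.thetaKernel θ) ≤ a * (M.m n * G) := by gcongr
    -- The facts `e3` to `e6` are the four pieces of the difference between the target and the bound
    -- obtained from `e1` and `e2`; they are nonnegative because m ≥ 1.
    have e3 : 0 ≤ (M.m n + 2 * m' - 1) * (m' * (S + N)) :=
      mul_nonneg (by linarith) (by positivity)
    have e4 : 0 ≤ m' * (a * G) := by positivity
    have e5 : 0 ≤ (M.m n + m' - 1) * b := mul_nonneg (by linarith) hb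
    have e6 : 0 ≤ (M.m n + 2 * m' - 1) * d' := mul_nonneg (by linarith) hd'.le
    nlinarith
  obtain ⟨A, B, hA, hB, hex⟩ := M.exit_bound hβ1 hδ0 hδ1
  have hexit : ∃ C, 0 ≤ C ∧ ∀ θ, ∫ z, |M.r z.1| ∂(M.thetaKernel θ) ≤ C * M.ell n a b m' d' θ := by
    -- For n ≤ 1 one has |ρ| ≤ |ρ^n|, so g already dominates the power in the exit bound. For n ≥ 2
    -- the quantity to be bounded is itself the first summand of ℓ, up to the factor m'.
    rcases lt_or_ge n 2 with hn | hn
    · refine ⟨A / d' + B / a, by positivity, fun θ => (hex θ).2.trans ?_⟩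
      have h1 : A ≤ A / d' * M.ell n a b m' d' θ := by
        rw [div_mul_eq_mul_div, le_div_iff₀ hd']
        exact mul_le_mul_of_nonneg_left (h.d'_le_ell θ) hA
      have h2 : (θ : ℝ) ^ ((1 - M.δ) * M.ρ) ≤ M.g n θ := by
        have h3 : (θ : ℝ) ^ ((1 - M.δ) * M.ρ) + (θ : ℝ) ^ (-((1 - M.δ) * M.ρ)) ≤ M.g n θ := by
          refine rpow_add_rpow_neg_le θ.2 ?_
          rw [abs_mul, abs_mul]
          refine mul_le_mul_of_nonneg_left ?_ (abs_nonneg _)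
          have h4 : |M.ρ| ≤ 1 := abs_le.2 ⟨hρ0.le, hρ1.le⟩
          interval_cases n <;> simp [h4]
        have h5 : 0 < (θ : ℝ) ^ (-((1 - M.δ) * M.ρ)) := Real.rpow_pos_of_pos θ.2 _
        linarith
      have h6 : a * M.g n θ ≤ M.ell n a b m' d' θ := by
        have := hsum0 θ
        rw [ell]
        have : 0 ≤ m' * ((∑ k ∈ Finset.range (n - 1), M.absExit k θ) + n * |M.c₀|) := by
          positivity
        linarith
      have h7 : B * (θ : ℝ) ^ ((1 - M.δ) * M.ρ) ≤ B / a * M.ell n a b m' d' θ := by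
        rw [div_mul_eq_mul_div, le_div_iff₀ ha, mul_assoc]
        refine mul_le_mul_of_nonneg_left ?_ hB
        rw [mul_comm]
        exact (mul_le_mul_of_nonneg_left h2 ha.le).trans h6
      linarith
    · refine ⟨1 / m', by positivity, fun θ => ?_⟩
      rw [div_mul_eq_mul_div, le_div_iff₀ hm', one_mul, mul_comm]
      have h1 : M.absExit 0 θ ≤ ∑ k ∈ Finset.range (n - 1), M.absExit k θ :=
        Finset.single_le_sum (f := fun k => M.absExit k θ) (fun k _ => M.absExit_nonneg k θ)
          (Finset.mem_range.2 (by omega))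
      have hg := M.g_pos n θ
      change m' * M.absExit 0 θ ≤ _
      rw [ell]
      have h2 : m' * M.absExit 0 θ ≤
          m' * ((∑ k ∈ Finset.range (n - 1), M.absExit k θ) + n * |M.c₀|) := by
        refine mul_le_mul_of_nonneg_left ?_ hm'.le
        have : 0 ≤ (n : ℝ) * |M.c₀| := by positivity
        linarith
      have : 0 ≤ a * M.g n θ := by positivity
      linarith
  obtain ⟨C, hC, hCe⟩ := hexit
  refine ⟨C + |M.c₀| / d', ?_, hpos, fun θ => (hi12 θ).add (integrable_const _),
    hdrift, by linarith, h.lt_one, by positivity, fun θ => ?_, fun θ => (hex θ).1, fun θ => ?_⟩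
  · unfold ell
    have h1 := M.measurable_absExit
    have h2 := M.measurable_g n
    fun_prop
  · have h1 : |M.c₀| ≤ |M.c₀| / d' * M.ell n a b m' d' θ := by
      rw [div_mul_eq_mul_div, le_div_iff₀ hd']
      exact mul_le_mul_of_nonneg_left (h.d'_le_ell θ) (abs_nonneg _)
    have h2 : 0 ≤ C * M.ell n a b m' d' θ := mul_nonneg hC (hpos θ).le
    linarith
  · have h2 : 0 ≤ |M.c₀| / d' * M.ell n a b m' d' θ := mul_nonneg (by positivity) (hpos θ).le
    linarith [hCe θ]

variable (M)

lemma exists_discount_m_lt_one (hβ1 : M.β < 1) (hρ0 : -1 < M.ρ) (hρ1 : M.ρ < 1) :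
    ∃ n, M.β * M.m n < 1 := by
  have h1 : Filter.Tendsto (fun n : ℕ => M.ρ ^ (2 * n)) Filter.atTop (nhds 0) := by
    simp only [pow_mul]
    refine tendsto_pow_atTop_nhds_zero_of_lt_one (sq_nonneg _) ?_
    exact (sq_lt_one_iff_abs_lt_one _).2 (abs_lt.2 ⟨hρ0, hρ1⟩)
  have h2 : Filter.Tendsto (fun n : ℕ => M.β * M.m n) Filter.atTop (nhds (M.β * 1)) := by
    refine Filter.Tendsto.const_mul _ ?_
    have h3 := (Real.continuous_exp.tendsto _).comp (h1.mul_const ((1 - M.δ) ^ 2 * (M.γu : ℝ)))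
    rw [zero_mul, Real.exp_zero] at h3
    exact h3
  exact (h2.eventually (gt_mem_nhds (by linarith))).exists

lemma exists_isAdmissible (hβ0 : 0 < M.β) (hβ1 : M.β < 1) (hδ0 : 0 ≤ M.δ) (hδ1 : M.δ ≠ 1)
    {n : ℕ} (hn : M.β * M.m n < 1) : ∃ a b m' d', M.IsAdmissible n a b m' d' := by
  have hm1 := M.one_le_m n
  obtain ⟨a, b, ha, hb, hab⟩ : ∃ a b : ℝ, 0 < a ∧ 0 ≤ b ∧
      ∀ k, n = k + 2 → ∀ θ, M.absExit (k + 1) θ ≤ a * M.g n θ + b := by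
    rcases lt_or_ge n 2 with h | h
    · exact ⟨1, 0, one_pos, le_rfl, fun k hk => by omega⟩
    · obtain ⟨k, rfl⟩ := Nat.exists_eq_add_of_le' h
      obtain ⟨A, B, hA, hB, hAB⟩ := M.absExit_bound hβ1 hδ0 hδ1 (k + 1)
      -- `B + 1` rather than `B` keeps the coefficient strictly positive.
      refine ⟨B + 1, A, by positivity, hA, fun j hj θ => ?_⟩
      obtain rfl : k = j := by omega
      have h1 : (θ : ℝ) ^ ((1 - M.δ) * M.ρ ^ (k + 1 + 1)) ≤ M.g (k + 2) θ := by
        have : 0 < (θ : ℝ) ^ (-((1 - M.δ) * M.ρ ^ (k + 2))) := Real.rpow_pos_of_pos θ.2 _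
        rw [g]
        linarith
      have h2 := M.g_pos (k + 2) θ
      have h3 := mul_le_mul_of_nonneg_left h1 hB
      linarith [(hAB θ).2]
  -- This choice puts β(m + 2m') halfway between βm and 1.
  set m' := (1 - M.β * M.m n) / (4 * M.β) with hm'
  have hm'0 : 0 < m' := div_pos (by linarith) (by linarith)
  have hlt : M.β * (M.m n + 2 * m') < 1 := by
    have : M.β * m' = (1 - M.β * M.m n) / 4 := by rw [hm']; field_simp
    linarith
  refine ⟨a, b, m', a * M.m n / (M.m n + 2 * m' - 1), hn, ha, hb, hab, hm'0, ?_, by linarith, hlt,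
    le_rfl⟩
  exact div_pos (by positivity) (by linarith)

end JobSearch

/-! ### Weighted supremum norms. -/

section WeightedNorm

variable {Y : Type} {ℓ f : Y → ℝ}

lemma memWeighted_iff [MeasurableSpace Y] (hℓ : ∀ y, 0 < ℓ y) :
    MemWeighted ℓ f ↔ Measurable f ∧ ∃ B, 0 ≤ B ∧ ∀ y, |f y| ≤ B * ℓ y := by
  refine and_congr_right fun _ => ⟨fun ⟨B, hB⟩ => ⟨max B 0, le_max_right _ _, fun y => ?_⟩,
    fun ⟨B, _, hB⟩ => ⟨B, ?_⟩⟩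
  · rw [← div_le_iff₀ (hℓ y)]
    exact (hB ⟨y, rfl⟩).trans (le_max_left _ _)
  · rintro _ ⟨y, rfl⟩
    exact (div_le_iff₀ (hℓ y)).2 (hB y)

lemma MemWeighted.abs_le [MeasurableSpace Y] (hℓ : ∀ y, 0 < ℓ y) (hf : MemWeighted ℓ f) (y : Y) :
    |f y| ≤ weightedNorm ℓ f * ℓ y := by
  rw [← div_le_iff₀ (hℓ y)]
  exact le_ciSup hf.2 y

lemma weightedNorm_le (hℓ : ∀ y, 0 < ℓ y) {B : ℝ} (hB : 0 ≤ B) (h : ∀ y, |f y| ≤ B * ℓ y) :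
    weightedNorm ℓ f ≤ B :=
  Real.iSup_le (fun y => (div_le_iff₀ (hℓ y)).2 (h y)) hB

lemma weightedNorm_nonneg (hℓ : ∀ y, 0 < ℓ y) : 0 ≤ weightedNorm ℓ f :=
  Real.iSup_nonneg fun y => div_nonneg (abs_nonneg _) (hℓ y).le

lemma MemWeighted.sub [MeasurableSpace Y] {g : Y → ℝ} (hℓ : ∀ y, 0 < ℓ y) (hf : MemWeighted ℓ f)
    (hg : MemWeighted ℓ g) : MemWeighted ℓ (f - g) := by
  refine (memWeighted_iff hℓ).2 ⟨hf.1.sub hg.1, weightedNorm ℓ f + weightedNorm ℓ g,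
    add_nonneg (weightedNorm_nonneg hℓ) (weightedNorm_nonneg hℓ), fun y => ?_⟩
  rw [add_mul]
  exact (abs_sub _ _).trans (add_le_add (hf.abs_le hℓ y) (hg.abs_le hℓ y))

end WeightedNorm

/-! ### The contraction and its fixed point. -/

namespace JobSearch

variable {M : JobSearch} {ℓ : PosReal → ℝ} {K C : ℝ}

lemma measurable_max_exit {ψ : PosReal → ℝ} (hψ : Measurable ψ) :
    Measurable fun z : PosReal × PosReal => max (M.r z.1) (ψ z.2) :=
  (M.measurable_r.comp measurable_fst).max (hψ.comp measurable_snd)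

lemma measurable_Q {ψ : PosReal → ℝ} (hψ : Measurable ψ) : Measurable (M.Q ψ) :=
  (((measurable_max_exit hψ).stronglyMeasurable.integral_kernel
    (κ := M.thetaKernel)).measurable.const_mul _).const_add _

namespace IsWeight

lemma integrable_of_abs_le (h : M.IsWeight ℓ K C) {ψ : PosReal → ℝ} {B : ℝ} (hψ : Measurable ψ)
    (hB : ∀ θ, |ψ θ| ≤ B * ℓ θ) (θ : PosReal) :
    Integrable (fun z : PosReal × PosReal => ψ z.2) (M.thetaKernel θ) :=
  ((h.integrable θ).const_mul B).mono' (hψ.comp measurable_snd).aestronglyMeasurable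
    (ae_of_all _ fun z => hB z.2)

lemma integrable_max (h : M.IsWeight ℓ K C) {ψ : PosReal → ℝ} (hψ : MemWeighted ℓ ψ)
    (θ : PosReal) :
    Integrable (fun z : PosReal × PosReal => max (M.r z.1) (ψ z.2)) (M.thetaKernel θ) :=
  (h.exit_integrable θ).sup (h.integrable_of_abs_le hψ.1 (hψ.abs_le h.pos) θ)

lemma integral_le (h : M.IsWeight ℓ K C) {B : ℝ} (hB : 0 ≤ B) (θ : PosReal) :
    ∫ z, B * ℓ z.2 ∂(M.thetaKernel θ) ≤ K * B * ℓ θ := by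
  rw [integral_const_mul]
  calc _ ≤ B * (K * ℓ θ) := mul_le_mul_of_nonneg_left (h.drift θ) hB
    _ = _ := by ring

lemma memWeighted_Q (h : M.IsWeight ℓ K C) (hβ0 : 0 < M.β) {ψ : PosReal → ℝ}
    (hψ : MemWeighted ℓ ψ) : MemWeighted ℓ (M.Q ψ) := by
  have hN := weightedNorm_nonneg (f := ψ) h.pos
  set N := weightedNorm ℓ ψ with hNdef
  have hC := h.const_nonneg
  have hK := h.growth_pos
  refine (memWeighted_iff h.pos).2 ⟨measurable_Q hψ.1, C + M.β * (C + K * N), by positivity,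
    fun θ => ?_⟩
  have hi : Integrable (fun z : PosReal × PosReal => |M.r z.1| + N * ℓ z.2) (M.thetaKernel θ) :=
    (h.exit_integrable θ).abs.add ((h.integrable θ).const_mul N)
  have h1 : |∫ z, max (M.r z.1) (ψ z.2) ∂(M.thetaKernel θ)| ≤ C * ℓ θ + K * N * ℓ θ := by
    refine abs_integral_le_integral_abs.trans ?_
    refine (integral_mono (h.integrable_max hψ θ).abs hi fun z => ?_).trans ?_
    · have h2 := hψ.abs_le h.pos z.2
      have h3 : 0 ≤ N * ℓ z.2 := mul_nonneg hN (h.pos _).le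
      refine (abs_max_le_max_abs_abs (a := M.r z.1) (b := ψ z.2)).trans (max_le ?_ ?_)
      · linarith
      · linarith [abs_nonneg (M.r z.1)]
    · rw [integral_add (h.exit_integrable θ).abs ((h.integrable θ).const_mul N)]
      exact add_le_add (h.exit θ) (h.integral_le hN θ)
  calc |M.Q ψ θ| ≤ |M.c₀| + |M.β * ∫ z, max (M.r z.1) (ψ z.2) ∂(M.thetaKernel θ)| :=
        abs_add_le _ _
    _ ≤ C * ℓ θ + M.β * (C * ℓ θ + K * N * ℓ θ) := by
        rw [abs_mul, abs_of_pos hβ0]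
        exact add_le_add (h.flow θ) (mul_le_mul_of_nonneg_left h1 hβ0.le)
    _ = _ := by ring

/-- Taking the maximum with r is 1-Lipschitz, and integrating ℓ costs a factor `K`. A free bound `B`
in place of the norm lets the estimate run on explicit geometric rates. -/
lemma abs_Q_sub_le (h : M.IsWeight ℓ K C) (hβ0 : 0 < M.β) {ψ φ : PosReal → ℝ}
    (hψ : MemWeighted ℓ ψ) (hφ : MemWeighted ℓ φ) {B : ℝ} (hB : 0 ≤ B)
    (hd : ∀ θ, |ψ θ - φ θ| ≤ B * ℓ θ) (θ : PosReal) :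
    |M.Q ψ θ - M.Q φ θ| ≤ M.β * K * B * ℓ θ := by
  have hi := h.integrable_max hψ θ
  have hi' := h.integrable_max hφ θ
  have e : M.Q ψ θ - M.Q φ θ = M.β * ∫ z, (max (M.r z.1) (ψ z.2) - max (M.r z.1) (φ z.2))
      ∂(M.thetaKernel θ) := by
    rw [integral_sub hi hi', Q, Q]; ring
  have h1 : |∫ z, (max (M.r z.1) (ψ z.2) - max (M.r z.1) (φ z.2)) ∂(M.thetaKernel θ)| ≤
      K * B * ℓ θ := by
    refine abs_integral_le_integral_abs.trans
      ((integral_mono (hi.sub hi').abs ((h.integrable θ).const_mul B) fun z => ?_).trans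
        (h.integral_le hB θ))
    refine le_trans ?_ (hd z.2)
    simpa [max_comm] using abs_max_sub_max_le_abs (ψ z.2) (φ z.2) (M.r z.1)
  rw [e, abs_mul, abs_of_pos hβ0]
  calc _ ≤ M.β * (K * B * ℓ θ) := mul_le_mul_of_nonneg_left h1 hβ0.le
    _ = _ := by ring

lemma isWeightedContraction_Q (h : M.IsWeight ℓ K C) (hβ0 : 0 < M.β) :
    IsWeightedContraction ℓ M.Q := by
  have hK := h.growth_pos
  refine ⟨fun ψ hψ => h.memWeighted_Q hβ0 hψ, M.β * K, by positivity, h.discount,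
    fun ψ φ hψ hφ => ?_⟩
  have hN := weightedNorm_nonneg (f := ψ - φ) h.pos
  exact weightedNorm_le h.pos (by positivity)
    (h.abs_Q_sub_le hβ0 hψ hφ hN ((hψ.sub h.pos hφ).abs_le h.pos))

lemma eq_of_fixed (h : M.IsWeight ℓ K C) (hβ0 : 0 < M.β) {ψ φ : PosReal → ℝ}
    (hψ : MemWeighted ℓ ψ) (hφ : MemWeighted ℓ φ) (hQψ : M.Q ψ = ψ) (hQφ : M.Q φ = φ) :
    ψ = φ := by
  have hN := weightedNorm_nonneg (f := ψ - φ) h.pos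
  have hd := (hψ.sub h.pos hφ).abs_le h.pos
  have hK := h.growth_pos
  have h1 : weightedNorm ℓ (ψ - φ) ≤ M.β * K * weightedNorm ℓ (ψ - φ) := by
    refine weightedNorm_le h.pos (by positivity) fun θ => ?_
    have := h.abs_Q_sub_le hβ0 hψ hφ hN hd θ
    rwa [hQψ, hQφ] at this
  have h2 : weightedNorm ℓ (ψ - φ) = 0 := by nlinarith [h.discount]
  funext θ
  have h3 := hd θ
  rw [h2, zero_mul] at h3
  exact sub_eq_zero.1 (abs_nonpos_iff.1 h3)

lemma memWeighted_zero (h : M.IsWeight ℓ K C) : MemWeighted ℓ (0 : PosReal → ℝ) :=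
  (memWeighted_iff h.pos).2 ⟨measurable_zero, 0, le_rfl, fun θ => by simp⟩

lemma memWeighted_iterate (h : M.IsWeight ℓ K C) (hβ0 : 0 < M.β) (k : ℕ) :
    MemWeighted ℓ (M.Q^[k] 0) := by
  induction k with
  | zero => exact h.memWeighted_zero
  | succ k ih =>
    rw [Function.iterate_succ_apply']
    exact h.memWeighted_Q hβ0 ih

/-- The fixed point of `Q`, obtained by successive approximation. -/
lemma exists_fixed (h : M.IsWeight ℓ K C) (hβ0 : 0 < M.β) :
    ∃ ψ, MemWeighted ℓ ψ ∧ M.Q ψ = ψ ∧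
      ∀ θ, Filter.Tendsto (fun k => (M.Q^[k] 0) θ) Filter.atTop (nhds (ψ θ)) := by
  have hK := h.growth_pos
  set κ := M.β * K with hκ
  have hκ0 : 0 < κ := by positivity
  have hκ1 : κ < 1 := h.discount
  have hmem := h.memWeighted_iterate hβ0
  set N := weightedNorm ℓ (M.Q 0) with hNdef
  have hN : 0 ≤ N := weightedNorm_nonneg h.pos
  have hstep : ∀ k θ, |(M.Q^[k + 1] 0) θ - (M.Q^[k] 0) θ| ≤ κ ^ k * N * ℓ θ := by
    intro k
    induction k with
    | zero => intro θ; simpa using (h.memWeighted_Q hβ0 h.memWeighted_zero).abs_le h.pos θ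
    | succ k ih =>
      intro θ
      have := h.abs_Q_sub_le hβ0 (hmem (k + 1)) (hmem k) (by positivity) ih θ
      rw [← Function.iterate_succ_apply' M.Q, ← Function.iterate_succ_apply' M.Q] at this
      refine this.trans (le_of_eq ?_)
      rw [pow_succ]; ring
  have hdist : ∀ θ k, dist ((M.Q^[k] 0) θ) ((M.Q^[k + 1] 0) θ) ≤ N * ℓ θ * κ ^ k := by
    intro θ k
    rw [dist_comm, Real.dist_eq]
    refine (hstep k θ).trans (le_of_eq (by ring))
  have hlim : ∀ θ, ∃ x, Filter.Tendsto (fun k => (M.Q^[k] 0) θ) Filter.atTop (nhds x) := fun θ =>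
    cauchySeq_tendsto_of_complete (cauchySeq_of_le_geometric κ _ hκ1 (hdist θ))
  choose ψ hψ using hlim
  have hψm : Measurable ψ := measurable_of_tendsto_metrizable (fun k => (hmem k).1)
    (tendsto_pi_nhds.2 hψ)
  -- The limit is taken pointwise, so completeness of b_ℓ is not needed: the case k = 0 of this
  -- rate, where the iterate is 0, shows that the limit is ℓ-bounded.
  have hrate : ∀ k θ, |(M.Q^[k] 0) θ - ψ θ| ≤ κ ^ k * (N / (1 - κ)) * ℓ θ := by
    intro k θ
    have := dist_le_of_le_geometric_of_tendsto κ _ hκ1 (hdist θ) (hψ θ) k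
    rw [Real.dist_eq] at this
    refine this.trans (le_of_eq (by ring))
  have h1κ : 0 < 1 - κ := by linarith
  have hψmem : MemWeighted ℓ ψ := by
    refine (memWeighted_iff h.pos).2 ⟨hψm, N / (1 - κ), by positivity, fun θ => ?_⟩
    simpa using hrate 0 θ
  refine ⟨ψ, hψmem, ?_, hψ⟩
  funext θ
  -- The shifted iterates converge to ψ by construction and to Qψ by the contraction estimate.
  refine tendsto_nhds_unique ?_ ((Filter.tendsto_add_atTop_iff_nat 1).2 (hψ θ))
  have hz : Filter.Tendsto (fun k : ℕ => κ * (κ ^ k * (N / (1 - κ))) * ℓ θ) Filter.atTop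
      (nhds 0) := by
    have := (((tendsto_pow_atTop_nhds_zero_of_lt_one hκ0.le hκ1).mul_const
      (N / (1 - κ))).const_mul κ).mul_const (ℓ θ)
    simpa using this
  rw [tendsto_iff_dist_tendsto_zero]
  refine squeeze_zero (fun _ => dist_nonneg) (fun k => ?_) hz
  rw [Function.iterate_succ_apply', Real.dist_eq]
  exact h.abs_Q_sub_le hβ0 (hmem k) hψmem (by positivity) (hrate k) θ

end IsWeight

end JobSearch

/-! ### Smoothness of expectations in the current state. -/

/-- Completing the square: a shift of the mean is an exponential tilt, so the parameter moves out of
the measure into a smooth density. -/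
lemma gaussianReal_eq_withDensity_exp {γ : ℝ≥0} (hγ : γ ≠ 0) (x : ℝ) :
    gaussianReal x γ = (gaussianReal 0 γ).withDensity fun y =>
      ENNReal.ofReal (Real.exp (x / γ * y) * Real.exp (-(x ^ 2 / (2 * γ)))) := by
  rw [gaussianReal_of_var_ne_zero _ hγ, gaussianReal_of_var_ne_zero _ hγ,
    ← withDensity_mul _ (measurable_gaussianPDF _ _) (by fun_prop)]
  congr 1
  funext y
  have hγ' : (γ : ℝ) ≠ 0 := by exact_mod_cast hγ
  rw [Pi.mul_apply, gaussianPDF, gaussianPDF, ← ENNReal.ofReal_mul (gaussianPDFReal_nonneg _ _ _),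
    gaussianPDFReal, gaussianPDFReal]
  have h : -(y - x) ^ 2 / (2 * γ) =
      -(y - 0) ^ 2 / (2 * γ) + (x / γ * y + -(x ^ 2 / (2 * γ))) := by
    field_simp
    ring
  rw [h, Real.exp_add, Real.exp_add, ← mul_assoc]

/-- Exponential integrals of an integrable family are smooth in the exponent. -/
lemma contDiff_integral_exp_mul {Ω : Type} [MeasurableSpace Ω] {μ : Measure Ω} {X F : Ω → ℝ}
    (hX : Measurable X) (hF : Measurable F)
    (hi : ∀ t : ℝ, Integrable (fun ω => Real.exp (t * X ω) * F ω) μ) :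
    ContDiff ℝ 1 fun t : ℝ => ∫ ω, Real.exp (t * X ω) * F ω ∂μ := by
  -- A nonnegative factor can be absorbed into the measure. The integral is then a moment generating
  -- function finite on all of ℝ, hence analytic.
  have hmgf : ∀ G : Ω → ℝ, Measurable G → (∀ ω, 0 ≤ G ω) →
      (∀ t : ℝ, Integrable (fun ω => Real.exp (t * X ω) * G ω) μ) →
      ContDiff ℝ 1 fun t : ℝ => ∫ ω, Real.exp (t * X ω) * G ω ∂μ := by
    intro G hG hG0 hGi
    set ν := μ.withDensity fun ω => ENNReal.ofReal (G ω) with hν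
    have hint : ∀ t : ℝ, Integrable (fun ω => Real.exp (t * X ω)) ν := by
      intro t
      rw [hν, integrable_withDensity_iff hG.ennreal_ofReal (ae_of_all _ fun _ => by simp)]
      simpa only [ENNReal.toReal_ofReal (hG0 _)] using hGi t
    have heq : (fun t : ℝ => ∫ ω, Real.exp (t * X ω) * G ω ∂μ) = mgf X ν := by
      funext t
      rw [mgf, hν, integral_withDensity_eq_integral_toReal_smul hG.ennreal_ofReal
        (ae_of_all _ fun _ => by simp)]
      simp only [ENNReal.toReal_ofReal (hG0 _), smul_eq_mul, mul_comm]
    rw [heq]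
    have huniv : integrableExpSet X ν = univ := eq_univ_of_forall hint
    exact contDiff_iff_contDiffAt.2 fun t =>
      (analyticAt_mgf (by rw [huniv, interior_univ]; trivial)).contDiffAt
  have hsplit : ∀ t : ℝ, ∀ ω, Real.exp (t * X ω) * F ω =
      Real.exp (t * X ω) * max (F ω) 0 - Real.exp (t * X ω) * max (-F ω) 0 := by
    intro t ω
    rw [← mul_sub, max_zero_sub_max_neg_zero_eq_self]
  have hdom : ∀ G : Ω → ℝ, Measurable G → (∀ ω, |G ω| ≤ |F ω|) →
      ∀ t : ℝ, Integrable (fun ω => Real.exp (t * X ω) * G ω) μ := by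
    intro G hG hGF t
    refine (hi t).mono (by fun_prop) (ae_of_all _ fun ω => ?_)
    rw [norm_mul, norm_mul]
    exact mul_le_mul_of_nonneg_left (hGF ω) (norm_nonneg _)
  have h1 := hdom (fun ω => max (F ω) 0) (hF.max measurable_const) fun ω => by
    rw [abs_of_nonneg (le_max_right _ _)]
    exact max_le (le_abs_self _) (abs_nonneg _)
  have h2 := hdom (fun ω => max (-F ω) 0) (hF.neg.max measurable_const) fun ω => by
    rw [abs_of_nonneg (le_max_right _ _)]
    exact max_le (neg_le_abs _) (abs_nonneg _)
  simp only [hsplit, integral_sub (h1 _) (h2 _)]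
  exact (hmgf _ (hF.max measurable_const) (fun _ => le_max_right _ _) h1).sub
    (hmgf _ (hF.neg.max measurable_const) (fun _ => le_max_right _ _) h2)

namespace JobSearch

variable (M : JobSearch)

/-- The law of `(log θ', ξ, η)` given `log θ' ∼ N(x, γu)`. -/
def logLaw (x : ℝ) : Measure (ℝ × PosReal × PosReal) :=
  (gaussianReal x M.γu).prod ((logNormal 0 M.γξ).prod (logNormal M.μη M.γη))

instance (x : ℝ) : IsProbabilityMeasure (M.logLaw x) := by
  unfold logLaw; infer_instance

/-- The next state in terms of `(log θ', ξ, η)`. -/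
def logNext (p : ℝ × PosReal × PosReal) : PosReal × PosReal :=
  (wage ⟨Real.exp p.1, Real.exp_pos _⟩ p.2.1 p.2.2, ⟨Real.exp p.1, Real.exp_pos _⟩)

lemma measurable_logNext : Measurable logNext := by
  have h : Measurable fun p : ℝ × PosReal × PosReal =>
      (⟨Real.exp p.1, Real.exp_pos _⟩ : PosReal) := Measurable.subtype_mk (by fun_prop)
  refine Measurable.prodMk ?_ h
  unfold wage
  exact Measurable.subtype_mk (by fun_prop)

/-- In logarithms the current state only shifts a Gaussian mean, to ρ log θ. -/
lemma thetaKernel_eq_map_logLaw (θ : PosReal) :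
    M.thetaKernel θ = (M.logLaw (M.ρ * Real.log θ)).map logNext := by
  set σ := (logNormal 0 M.γξ).prod (logNormal M.μη M.γη) with hσ
  set x := M.ρ * Real.log θ with hx
  have h1 : M.shockLaw = ((gaussianReal 0 M.γu).prod σ).map
      (Prod.map (fun y : ℝ => (⟨Real.exp y, Real.exp_pos y⟩ : PosReal)) id) := by
    rw [shockLaw, ← Measure.map_prod_map _ _ measurable_posExp measurable_id, Measure.map_id,
      ← hσ]
    rfl
  have h2 : M.logLaw x = ((gaussianReal 0 M.γu).prod σ).map (Prod.map (x + ·) id) := by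
    rw [logLaw, ← Measure.map_prod_map _ _ (measurable_const_add x) measurable_id, Measure.map_id,
      gaussianReal_map_const_add, zero_add, hσ]
  have hm1 : Measurable (Prod.map (fun y : ℝ => (⟨Real.exp y, Real.exp_pos y⟩ : PosReal))
      (id : PosReal × PosReal → PosReal × PosReal)) := measurable_posExp.prodMap measurable_id
  have hm2 : Measurable (Prod.map (x + ·) (id : PosReal × PosReal → PosReal × PosReal)) :=
    (measurable_const_add x).prodMap measurable_id
  change M.shockLaw.map (M.next θ) = _
  rw [h1, h2, Measure.map_map (M.measurable_next_right θ) hm1,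
    Measure.map_map measurable_logNext hm2]
  congr 1
  funext p
  have h3 : M.nextTheta θ ⟨Real.exp p.1, Real.exp_pos p.1⟩ =
      ⟨Real.exp (x + p.1), Real.exp_pos _⟩ := by
    apply Subtype.ext
    change (θ : ℝ) ^ M.ρ * Real.exp p.1 = Real.exp (x + p.1)
    rw [Real.exp_add, Real.rpow_def_of_pos θ.2, hx, mul_comm M.ρ]
  simp only [Function.comp_apply, next, logNext, Prod.map_fst, Prod.map_snd, id, h3]

lemma logLaw_eq_withDensity (hγ : 0 < M.γu) (x : ℝ) :
    M.logLaw x = (M.logLaw 0).withDensity fun p =>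
      ENNReal.ofReal (Real.exp (x / M.γu * p.1) * Real.exp (-(x ^ 2 / (2 * M.γu)))) := by
  rw [logLaw, gaussianReal_eq_withDensity_exp hγ.ne', logLaw,
    prod_withDensity_left (by fun_prop)]

/-- Expectations of the next state are continuously differentiable functions of `θ`. -/
lemma isC1_integral_thetaKernel (hγ : 0 < M.γu) {f : PosReal × PosReal → ℝ} (hf : Measurable f)
    (hi : ∀ θ, Integrable f (M.thetaKernel θ)) : IsC1 fun θ => ∫ z, f z ∂(M.thetaKernel θ) := by
  -- For ρ = 0 the transition does not depend on θ. Otherwise ρ log θ takes every real value, which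
  -- yields integrability under all means `x`.
  rcases eq_or_ne M.ρ 0 with hρ | hρ
  · have h1 : (0 : ℝ) < 1 := one_pos
    refine ⟨fun _ => ∫ z, f z ∂(M.thetaKernel ⟨1, h1⟩), contDiffOn_const, fun θ => ?_⟩
    beta_reduce
    rw [thetaKernel_eq_map_logLaw, thetaKernel_eq_map_logLaw, hρ, zero_mul, zero_mul]
  have hγ' : (M.γu : ℝ) ≠ 0 := by exact_mod_cast hγ.ne'
  set F : ℝ × PosReal × PosReal → ℝ := fun p => f (logNext p) with hF
  have hFm : Measurable F := hf.comp measurable_logNext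
  have hFi : ∀ x, Integrable F (M.logLaw x) := by
    intro x
    have h := hi ⟨Real.exp (x / M.ρ), Real.exp_pos _⟩
    rw [thetaKernel_eq_map_logLaw, integrable_map_measure hf.aestronglyMeasurable
      measurable_logNext.aemeasurable] at h
    simpa [Function.comp_def, mul_div_cancel₀ x hρ] using h
  have hdens : ∀ x, Measurable fun p : ℝ × PosReal × PosReal => ENNReal.ofReal
      (Real.exp (x / M.γu * p.1) * Real.exp (-(x ^ 2 / (2 * M.γu)))) := fun x => by fun_prop
  -- The mean tγ_u produces exactly the tilt e^{ty}; dividing by the constant part of the density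
  -- leaves the claim.
  have hexp : ∀ t : ℝ, Integrable (fun p : ℝ × PosReal × PosReal => Real.exp (t * p.1) * F p)
      (M.logLaw 0) := by
    intro t
    have h := hFi (t * M.γu)
    rw [M.logLaw_eq_withDensity hγ, integrable_withDensity_iff (hdens _)
      (ae_of_all _ fun _ => by simp)] at h
    have h2 := h.mul_const (Real.exp (-((t * M.γu) ^ 2 / (2 * M.γu))))⁻¹
    refine h2.congr (ae_of_all _ fun p => ?_)
    have h3 := (Real.exp_pos (-((t * M.γu) ^ 2 / (2 * M.γu)))).ne'
    simp only
    rw [ENNReal.toReal_ofReal (by positivity), mul_div_cancel_right₀ _ hγ']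
    field_simp
  have hC := contDiff_integral_exp_mul measurable_fst hFm hexp
  refine ⟨fun y => Real.exp (-((M.ρ * Real.log y) ^ 2 / (2 * M.γu))) *
    ∫ p, Real.exp (M.ρ * Real.log y / M.γu * p.1) * F p ∂(M.logLaw 0), ?_, fun θ => ?_⟩
  · have hlog : ContDiffOn ℝ 1 Real.log (Ioi 0) :=
      Real.contDiffOn_log.mono fun y hy => ne_of_gt hy
    refine ContDiffOn.mul ?_ ?_
    · exact (((contDiffOn_const.mul hlog).pow 2).div_const _).neg.exp
    · exact hC.comp_contDiffOn ((contDiffOn_const.mul hlog).div_const _)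
  · beta_reduce
    rw [thetaKernel_eq_map_logLaw, integral_map measurable_logNext.aemeasurable
      hf.aestronglyMeasurable, M.logLaw_eq_withDensity hγ (M.ρ * Real.log θ),
      integral_withDensity_eq_integral_toReal_smul (hdens _) (ae_of_all _ fun _ => by simp),
      ← integral_const_mul]
    refine integral_congr_ae (ae_of_all _ fun p => ?_)
    simp only [smul_eq_mul]
    rw [ENNReal.toReal_ofReal (by positivity)]
    ring

end JobSearch

lemma IsC1.continuous {f : PosReal → ℝ} (hf : IsC1 f) : Continuous f := by
  obtain ⟨F, hF, hFf⟩ := hf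
  have h : f = fun x : PosReal => F x := funext fun x => (hFf x).symm
  rw [h]
  exact continuousOn_iff_continuous_domRestrict.1 hF.continuousOn

/-! ### Tightness of the state and finiteness of threshold policies. -/

lemma gaussianReal_pos_of_Icc_subset (μ : ℝ) {γ : ℝ≥0} (hγ : γ ≠ 0) {a b : ℝ} (hab : a < b)
    {s : Set ℝ} (hs : Icc a b ⊆ s) : 0 < gaussianReal μ γ s := by
  refine lt_of_lt_of_le (pos_iff_ne_zero.2 fun h => ?_) (measure_mono hs)
  have h1 := gaussianReal_absolutelyContinuous' μ hγ h
  rw [Real.volume_Icc, ENNReal.ofReal_eq_zero] at h1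
  linarith

lemma logNormal_pos_of_exp_mem (μ : ℝ) {γ : ℝ≥0} (hγ : γ ≠ 0) {s : Set PosReal}
    (hs : MeasurableSet s) {a b : ℝ} (hab : a < b)
    (h : ∀ x ∈ Icc a b, (⟨Real.exp x, Real.exp_pos x⟩ : PosReal) ∈ s) :
    0 < logNormal μ γ s := by
  rw [logNormal, Measure.map_apply measurable_posExp hs]
  exact gaussianReal_pos_of_Icc_subset μ hγ hab h

namespace JobSearch

open scoped ENNReal

section Recurrence

variable (M : JobSearch)

lemma measurable_abs_log : Measurable fun z : PosReal × PosReal => |Real.log z.2| :=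
  (Real.measurable_log.comp (measurable_subtype_coe.comp measurable_snd)).abs

lemma log_nextTheta (θ u : PosReal) :
    Real.log (M.nextTheta θ u) = M.ρ * Real.log θ + Real.log u := by
  rw [nextTheta, Real.log_mul (Real.rpow_pos_of_pos θ.2 _).ne' (posReal_pos u).ne',
    Real.log_rpow θ.2]

lemma exists_log_drift : ∃ c : ℝ, 0 ≤ c ∧ ∀ z,
    ∫⁻ y, ENNReal.ofReal |Real.log y.2| ∂(M.kernel z) ≤
      ENNReal.ofReal |M.ρ| * ENNReal.ofReal |Real.log z.2| + ENNReal.ofReal c := by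
  -- The function u + 1/u dominates |log u|, by log x ≤ x - 1 at u and at 1/u, and its mean is the
  -- constant sought.
  set f : PosReal × PosReal × PosReal → ℝ := fun s => (s.1 : ℝ) ^ (1 : ℝ) + (s.1 : ℝ) ^ (-1 : ℝ)
    with hf
  have hfi : Integrable f M.shockLaw := by
    have h1 := M.integrable_shock_rpow 1 0 0
    have h2 := M.integrable_shock_rpow (-1) 0 0
    simp only [Real.rpow_zero, mul_one] at h1 h2
    exact h1.add h2
  have hf0 : ∀ s, 0 ≤ f s := fun s =>
    add_nonneg (Real.rpow_nonneg (posReal_pos _).le _) (Real.rpow_nonneg (posReal_pos _).le _)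
  have hlog : ∀ s : PosReal × PosReal × PosReal, |Real.log s.1| ≤ f s := by
    intro s
    have h0 := posReal_pos s.1
    have h1 := Real.log_le_sub_one_of_pos h0
    have h2 := Real.log_le_sub_one_of_pos (inv_pos.2 h0)
    rw [Real.log_inv] at h2
    have h3 := inv_pos.2 h0
    rw [hf]
    simp only [Real.rpow_one, Real.rpow_neg_one]
    exact abs_le.2 ⟨by linarith, by linarith⟩
  refine ⟨∫ s, f s ∂M.shockLaw, integral_nonneg hf0, fun z => ?_⟩
  have hm : Measurable fun y : PosReal × PosReal => ENNReal.ofReal |Real.log y.2| :=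
    measurable_abs_log.ennreal_ofReal
  change ∫⁻ y, ENNReal.ofReal |Real.log y.2| ∂(M.shockLaw.map (M.next z.2)) ≤ _
  rw [lintegral_map hm (M.measurable_next_right z.2)]
  calc _ ≤ ∫⁻ s, (ENNReal.ofReal |M.ρ| * ENNReal.ofReal |Real.log z.2| + ENNReal.ofReal (f s))
          ∂M.shockLaw := by
        refine lintegral_mono fun s => ?_
        rw [← ENNReal.ofReal_mul (abs_nonneg _), ← ENNReal.ofReal_add (by positivity) (hf0 s)]
        refine ENNReal.ofReal_le_ofReal ?_
        simp only [next, log_nextTheta]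
        refine (abs_add_le _ _).trans (add_le_add ?_ (hlog s))
        rw [abs_mul]
    _ = _ := by
        rw [lintegral_add_left measurable_const, ofReal_integral_eq_lintegral_ofReal hfi
          (ae_of_all _ hf0)]
        simp

/-- The log of the persistent state is bounded in `L¹` along the process. -/
lemma exists_log_bound (hρ0 : -1 < M.ρ) (hρ1 : M.ρ < 1) (z : PosReal × PosReal) :
    ∃ D : ℝ, 0 ≤ D ∧ ∀ t : ℕ, ∫⁻ ω, ENNReal.ofReal |Real.log (ω t).2|
      ∂(OptStop.pathMeasure M.kernel z) ≤ ENNReal.ofReal D := by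
  obtain ⟨c, hc, hdrift⟩ := M.exists_log_drift
  have hρ : |M.ρ| < 1 := abs_lt.2 ⟨hρ0, hρ1⟩
  have hρ' : 0 < 1 - |M.ρ| := by linarith
  have hm : Measurable fun y : PosReal × PosReal => ENNReal.ofReal |Real.log y.2| :=
    measurable_abs_log.ennreal_ofReal
  -- `D` dominates the initial value and satisfies |ρ|D + c ≤ D, so the bound reproduces itself.
  set D := |Real.log z.2| + c / (1 - |M.ρ|) with hD
  have hq : 0 ≤ c / (1 - |M.ρ|) := by positivity
  have hD0 : 0 ≤ D := by positivity
  refine ⟨D, hD0, fun t => ?_⟩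
  induction t with
  | zero =>
    rw [OptStop.lintegral_eval_zero (f := fun y : PosReal × PosReal =>
      ENNReal.ofReal |Real.log y.2|) hm]
    exact ENNReal.ofReal_le_ofReal (by linarith)
  | succ t ih =>
    rw [OptStop.lintegral_eval_succ (f := fun y : PosReal × PosReal =>
      ENNReal.ofReal |Real.log y.2|) hm]
    have hmt : Measurable fun ω : ℕ → PosReal × PosReal => ENNReal.ofReal |Real.log (ω t).2| :=
      hm.comp (measurable_pi_apply t)
    have h1 : ∫⁻ ω, ∫⁻ y, ENNReal.ofReal |Real.log y.2| ∂(M.kernel (ω t))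
          ∂(OptStop.pathMeasure M.kernel z) ≤
        ∫⁻ ω, (ENNReal.ofReal |M.ρ| * ENNReal.ofReal |Real.log (ω t).2| + ENNReal.ofReal c)
          ∂(OptStop.pathMeasure M.kernel z) := lintegral_mono fun ω => hdrift (ω t)
    rw [lintegral_add_right _ measurable_const, lintegral_const_mul _ hmt] at h1
    simp only [lintegral_const, measure_univ, mul_one] at h1
    refine h1.trans ?_
    refine le_trans (b := ENNReal.ofReal |M.ρ| * ENNReal.ofReal D + ENNReal.ofReal c)
      (by gcongr) ?_
    rw [← ENNReal.ofReal_mul (abs_nonneg _), ← ENNReal.ofReal_add (by positivity) hc]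
    refine ENNReal.ofReal_le_ofReal ?_
    have e : (1 - |M.ρ|) * (c / (1 - |M.ρ|)) = c := by field_simp
    have e2 : 0 ≤ (1 - |M.ρ|) * |Real.log z.2| := by positivity
    nlinarith

lemma exists_tight (hρ0 : -1 < M.ρ) (hρ1 : M.ρ < 1) (z : PosReal × PosReal) {q : ℝ≥0∞}
    (hq : 0 < q) : ∃ R : ℝ, ∀ t : ℕ,
      OptStop.pathMeasure M.kernel z {ω | ¬ |Real.log (ω t).2| ≤ R} ≤ q := by
  obtain ⟨D, hD, hb⟩ := M.exists_log_bound hρ0 hρ1 z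
  have hm : Measurable fun y : PosReal × PosReal => ENNReal.ofReal |Real.log y.2| :=
    measurable_abs_log.ennreal_ofReal
  -- The truncation at 1 makes `q`, possibly infinite, a positive real for Markov's inequality.
  set p := (min q 1).toReal with hp
  have hmin : min q 1 ≠ ⊤ := ne_top_of_le_ne_top ENNReal.one_ne_top (min_le_right _ _)
  have hp0 : 0 < p := ENNReal.toReal_pos (lt_min hq one_pos).ne' hmin
  set R := (D + 1) / p with hR
  have hR0 : 0 < R := by positivity
  refine ⟨R, fun t => ?_⟩
  have h1 := meas_ge_le_lintegral_div (μ := OptStop.pathMeasure M.kernel z)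
    (hm.comp (measurable_pi_apply t)).aemeasurable (ε := ENNReal.ofReal R)
    (ENNReal.ofReal_pos.2 hR0).ne' ENNReal.ofReal_ne_top
  refine le_trans (measure_mono fun ω hω => ?_) (h1.trans ?_)
  · exact ENNReal.ofReal_le_ofReal (not_le.1 hω).le
  · refine ENNReal.div_le_of_le_mul ((hb t).trans ?_)
    calc ENNReal.ofReal D ≤ ENNReal.ofReal (p * R) := by
          refine ENNReal.ofReal_le_ofReal ?_
          rw [hR, mul_div_cancel₀ _ hp0.ne']
          linarith
      _ = min q 1 * ENNReal.ofReal R := by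
          rw [ENNReal.ofReal_mul hp0.le, hp, ENNReal.ofReal_toReal hmin]
      _ ≤ q * ENNReal.ofReal R := by gcongr; exact min_le_left _ _

/-- From a bounded set of persistent states, the wage exceeds a continuous threshold next period
with probability bounded away from zero. -/
lemma exists_pos_le_thetaKernel (hu : 0 < M.γu) (hη : 0 < M.γη) {wbar : PosReal → PosReal}
    (hw : Continuous wbar) (hρ : |M.ρ| ≤ 1) (R : ℝ) :
    ∃ ε : ℝ≥0∞, 0 < ε ∧ ∀ θ : PosReal, |Real.log θ| ≤ R →
      ε ≤ M.thetaKernel θ {z | wbar z.2 ≤ z.1} := by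
  have hexp : Continuous fun x : ℝ => (⟨Real.exp x, Real.exp_pos x⟩ : PosReal) :=
    Real.continuous_exp.subtype_mk _
  -- If |log u| ≤ 1 then |log θ'| ≤ R + 1, a compact range on which the threshold is at most `B`.
  -- Then η ≥ B already forces w' above it, whatever ξ is; the two events are independent with
  -- positive probability.
  obtain ⟨B, hB⟩ := (isCompact_Icc (a := -(R + 1)) (b := R + 1)).bddAbove_image
    (continuous_subtype_val.comp (hw.comp hexp)).continuousOn
  have hlogm : Measurable fun u : PosReal => Real.log u :=
    Real.measurable_log.comp measurable_subtype_coe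
  set U : Set PosReal := {u | |Real.log u| ≤ 1} with hU
  set H : Set PosReal := {x | B ≤ (x : ℝ)} with hH
  have hUm : MeasurableSet U := measurableSet_le hlogm.abs measurable_const
  have hHm : MeasurableSet H := measurableSet_le measurable_const measurable_subtype_coe
  have hUpos : 0 < logNormal 0 M.γu U :=
    logNormal_pos_of_exp_mem 0 hu.ne' hUm (a := -1) (b := 1) (by norm_num) fun x hx => by
      rw [hU, mem_ofPred_eq, Real.log_exp]
      exact abs_le.2 hx
  have hHpos : 0 < logNormal M.μη M.γη H :=
    logNormal_pos_of_exp_mem _ hη.ne' hHm (a := B) (b := B + 1) (by linarith) fun x hx => by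
      rw [hH, mem_ofPred_eq]
      have := Real.add_one_le_exp x
      exact le_trans (by linarith [hx.1]) this
  have hSm : MeasurableSet {z : PosReal × PosReal | wbar z.2 ≤ z.1} :=
    measurableSet_le (hw.measurable.comp measurable_snd) measurable_fst
  refine ⟨logNormal 0 M.γu U * logNormal M.μη M.γη H, ENNReal.mul_pos hUpos.ne' hHpos.ne',
    fun θ hθ => ?_⟩
  have h1 : M.shockLaw (U ×ˢ (univ ×ˢ H)) = logNormal 0 M.γu U * logNormal M.μη M.γη H := by
    rw [shockLaw, Measure.prod_prod, Measure.prod_prod, measure_univ, one_mul]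
  change _ ≤ M.shockLaw.map (M.next θ) _
  rw [← h1, Measure.map_apply (M.measurable_next_right θ) hSm]
  refine measure_mono fun s hs => ?_
  have hs1 : |Real.log s.1| ≤ 1 := hs.1
  have hs2 : B ≤ (s.2.2 : ℝ) := hs.2.2
  have hlog : |Real.log (M.nextTheta θ s.1)| ≤ R + 1 := by
    rw [log_nextTheta]
    refine (abs_add_le _ _).trans (add_le_add ?_ hs1)
    rw [abs_mul]
    exact (mul_le_of_le_one_left (abs_nonneg _) hρ).trans hθ
  have h2 : ((wbar ⟨Real.exp (Real.log (M.nextTheta θ s.1)), Real.exp_pos _⟩ : PosReal) : ℝ) ≤ B :=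
    hB ⟨Real.log (M.nextTheta θ s.1), abs_le.1 hlog, rfl⟩
  have h3 : (⟨Real.exp (Real.log (M.nextTheta θ s.1)), Real.exp_pos _⟩ : PosReal) =
      M.nextTheta θ s.1 := Subtype.ext (Real.exp_log (posReal_pos _))
  rw [h3] at h2
  change ((wbar (M.nextTheta θ s.1) : PosReal) : ℝ) ≤
    (s.2.2 : ℝ) + (M.nextTheta θ s.1 : ℝ) * (s.2.1 : ℝ)
  have h4 := mul_pos (posReal_pos (M.nextTheta θ s.1)) (posReal_pos s.2.1)
  linarith

/-- Reservation-wage policies with continuous thresholds stop in finite time almost surely. -/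
lemma isFiniteStoppingTime_threshold (hu : 0 < M.γu) (hη : 0 < M.γη) (hρ0 : -1 < M.ρ)
    (hρ1 : M.ρ < 1) {wbar : PosReal → PosReal} (hw : Continuous wbar) (z : PosReal × PosReal) :
    OptStop.IsFiniteStoppingTime M.kernel z
      (hittingAfter (fun (t : ℕ) (ω : ℕ → PosReal × PosReal) => ω t) {z | wbar z.2 ≤ z.1} 0) := by
  refine OptStop.isFiniteStoppingTime_hitting
    (measurableSet_le (hw.measurable.comp measurable_snd) measurable_fst) z fun q hq => ?_
  obtain ⟨R, hR⟩ := M.exists_tight hρ0 hρ1 z hq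
  obtain ⟨ε, hε, hεS⟩ := M.exists_pos_le_thetaKernel hu hη hw (abs_le.2 ⟨hρ0.le, hρ1.le⟩) R
  exact ⟨{y | |Real.log y.2| ≤ R}, measurableSet_le measurable_abs_log measurable_const, hR, ε, hε,
    fun y hy => hεS y.2 hy⟩

end Recurrence

/-! ### The reservation wage as inverse of the exit payoff. -/

section ReservationWage

variable {M : JobSearch}

lemma strictMono_r (hβ1 : M.β < 1) (hδ1 : M.δ ≠ 1) : StrictMono M.r := by
  intro x y hxy
  have hxy' : (x : ℝ) < y := hxy
  have h1 : 0 < 1 - M.β := sub_pos.2 hβ1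
  rw [M.r_eq hδ1, M.r_eq hδ1]
  rcases lt_or_gt_of_ne (sub_ne_zero.2 hδ1.symm) with h | h
  · exact div_lt_div_of_neg_of_lt (mul_neg_of_pos_of_neg h1 h)
      (Real.rpow_lt_rpow_of_neg x.2 hxy' h)
  · exact div_lt_div_of_pos_right (Real.rpow_lt_rpow (posReal_pos x).le hxy' h) (mul_pos h1 h)

/-- The scaling absorbs the sign of 1 - δ, so that δ < 1 and δ > 1 are inverted by the same power.
-/
lemma scaled_r (hβ1 : M.β < 1) (hδ1 : M.δ ≠ 1) (w : PosReal) :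
    (1 - M.β) * (1 - M.δ) * M.r w = (w : ℝ) ^ (1 - M.δ) := by
  rw [M.r_eq hδ1, mul_div_cancel₀]
  exact mul_ne_zero (sub_pos.2 hβ1).ne' (sub_ne_zero.2 hδ1.symm)

lemma scaled_c₀_pos (hδ1 : M.δ ≠ 1) (hcomp : 0 < M.comp) :
    0 < (1 - M.δ) * M.c₀ := by
  rw [c₀, crra, if_neg hδ1, mul_div_cancel₀ _ (sub_ne_zero.2 hδ1.symm)]
  exact Real.rpow_pos_of_pos hcomp _

/-- The reservation wage associated with a continuation value. -/
def reservationWage (M : JobSearch) (ψ : PosReal → ℝ)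
    (h : ∀ θ, 0 < (1 - M.β) * (1 - M.δ) * ψ θ) (θ : PosReal) : PosReal :=
  ⟨((1 - M.β) * (1 - M.δ) * ψ θ) ^ (1 / (1 - M.δ)), Real.rpow_pos_of_pos (h θ) _⟩

variable {ψ : PosReal → ℝ} (hψ : ∀ θ, 0 < (1 - M.β) * (1 - M.δ) * ψ θ)

lemma r_eq_iff (hβ1 : M.β < 1) (hδ1 : M.δ ≠ 1) (θ w : PosReal) :
    M.r w = ψ θ ↔ w = M.reservationWage ψ hψ θ := by
  have hs : 1 - M.δ ≠ 0 := sub_ne_zero.2 hδ1.symm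
  have h0 : (1 - M.β) * (1 - M.δ) ≠ 0 := mul_ne_zero (sub_pos.2 hβ1).ne' hs
  rw [← mul_right_inj' h0, scaled_r hβ1 hδ1, Subtype.ext_iff]
  change _ ↔ (w : ℝ) = ((1 - M.β) * (1 - M.δ) * ψ θ) ^ (1 / (1 - M.δ))
  rw [one_div]
  exact (Real.eq_rpow_inv (posReal_pos w).le (hψ θ).le hs).symm

lemma reservationWage_le_iff (hβ1 : M.β < 1) (hδ1 : M.δ ≠ 1) (θ w : PosReal) :
    M.reservationWage ψ hψ θ ≤ w ↔ ψ θ ≤ M.r w := by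
  rw [← (strictMono_r hβ1 hδ1).le_iff_le, (r_eq_iff hψ hβ1 hδ1 θ _).2 rfl]

lemma isC1_reservationWage (h : IsC1 ψ) : IsC1 fun θ => (M.reservationWage ψ hψ θ : ℝ) := by
  obtain ⟨F, hF, hFψ⟩ := h
  refine ⟨fun x => ((1 - M.β) * (1 - M.δ) * F x) ^ (1 / (1 - M.δ)), ?_, fun θ => ?_⟩
  · refine (contDiffOn_const.mul hF).rpow_const_of_ne fun x hx => ?_
    have := hψ ⟨x, hx⟩
    rw [← hFψ] at this
    exact this.ne'
  · beta_reduce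
    rw [hFψ]
    rfl

lemma monotone_reservationWage (hβ1 : M.β < 1) (hδ1 : M.δ ≠ 1) (h : Monotone ψ) :
    Monotone (M.reservationWage ψ hψ) := by
  intro x y hxy
  rw [reservationWage_le_iff hψ hβ1 hδ1, (r_eq_iff hψ hβ1 hδ1 y _).2 rfl]
  exact h hxy

end ReservationWage

/-! ### From the fixed point of Q to the stopping problem. -/

section FixedPoint

variable {M : JobSearch} {ℓ ψ : PosReal → ℝ} {K C : ℝ}

/-- The exit payoff depends on w, which ℓ does not see, so |r| is added. Its one-step mean is at
most Cℓ, which a large multiple of ℓ absorbs after raising the growth rate from `K` to `K'`, still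
below 1/β. -/
lemma IsWeight.exists_isDriftWeight (h : M.IsWeight ℓ K C) (hβ0 : 0 < M.β) {N : ℝ}
    (hN : 0 ≤ N) : ∃ D K', N ≤ D ∧ OptStop.IsDriftWeight M.kernel M.β
      (fun z => ENNReal.ofReal (|M.r z.1| + D * ℓ z.2)) K' := by
  have hK := h.growth_pos
  have hC := h.const_nonneg
  have hKβ : K < 1 / M.β := by
    rw [lt_div_iff₀ hβ0, mul_comm]
    exact h.discount
  obtain ⟨K', hK', hK'1⟩ := exists_between hKβ
  have hd : 0 < K' - K := by linarith
  set D := N + C / (K' - K) with hD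
  have hD0 : 0 ≤ D := by positivity
  have hDC : C + K * D ≤ K' * D := by
    have h1 : (K' - K) * (C / (K' - K)) = C := by field_simp
    have h2 : 0 ≤ (K' - K) * N := by positivity
    nlinarith
  have hnn : ∀ z : PosReal × PosReal, 0 ≤ |M.r z.1| + D * ℓ z.2 := fun z =>
    add_nonneg (abs_nonneg _) (mul_nonneg hD0 (h.pos _).le)
  have hi : ∀ θ, Integrable (fun z : PosReal × PosReal => |M.r z.1| + D * ℓ z.2)
      (M.thetaKernel θ) := fun θ => (h.exit_integrable θ).abs.add ((h.integrable θ).const_mul D)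
  refine ⟨D, ENNReal.ofReal K', le_add_of_nonneg_right (by positivity), ?_,
    fun z => ENNReal.ofReal_ne_top, fun z => ?_, ?_⟩
  · exact (((M.measurable_r.comp measurable_fst).abs).add
      ((h.measurable.comp measurable_snd).const_mul D)).ennreal_ofReal
  · rw [kernel_apply, ← ofReal_integral_eq_lintegral_ofReal (hi z.2) (ae_of_all _ hnn),
      ← ENNReal.ofReal_mul (hK.trans hK').le]
    refine ENNReal.ofReal_le_ofReal ?_
    rw [integral_add (h.exit_integrable z.2).abs ((h.integrable z.2).const_mul D)]
    have h1 := add_le_add (h.exit z.2) (h.integral_le hD0 z.2)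
    have h2 := mul_le_mul_of_nonneg_right hDC (h.pos z.2).le
    have h3 : 0 ≤ K' * |M.r z.1| := mul_nonneg (hK.trans hK').le (abs_nonneg _)
    nlinarith
  · rw [← ENNReal.ofReal_mul hβ0.le, ENNReal.ofReal_lt_one, mul_comm]
    exact (lt_div_iff₀ hβ0).1 hK'1

/-- The fixed point of `Q` has the sign of `1 - δ`. -/
lemma scaled_fixed_pos (hβ0 : 0 < M.β) (hβ1 : M.β < 1) (hδ1 : M.δ ≠ 1)
    (hcomp : 0 < M.comp) (hQ : M.Q ψ = ψ)
    (hlim : ∀ θ, Filter.Tendsto (fun k => (M.Q^[k] 0) θ) Filter.atTop (nhds (ψ θ))) (θ : PosReal) :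
    0 < (1 - M.β) * (1 - M.δ) * ψ θ := by
  have h1 : 0 < 1 - M.β := sub_pos.2 hβ1
  have hc := scaled_c₀_pos hδ1 hcomp
  have hr : ∀ w, 0 < (1 - M.β) * (1 - M.δ) * M.r w := fun w => by
    rw [scaled_r hβ1 hδ1]
    exact Real.rpow_pos_of_pos w.2 _
  rw [mul_assoc]
  refine mul_pos h1 ?_
  rcases lt_or_gt_of_ne (sub_ne_zero.2 hδ1.symm) with hs | hs
  -- When δ > 1, r is negative, but max{r, ψ} could still be positive; the sign of ψ is first
  -- obtained from the iterates, then sharpened by one application of Q to ψ ≤ c₀ < 0.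
  · have hr' : ∀ w, M.r w ≤ 0 := fun w => by
      have := hr w
      by_contra hw
      have h2 := mul_neg_of_pos_of_neg h1 hs
      nlinarith [not_le.1 hw]
    have hc' : M.c₀ < 0 := by
      by_contra hw
      nlinarith [not_lt.1 hw]
    have hQneg : ∀ φ : PosReal → ℝ, (∀ θ, φ θ ≤ 0) → ∀ θ, M.Q φ θ ≤ M.c₀ := by
      intro φ hφ θ
      rw [Q, add_le_iff_nonpos_right]
      exact mul_nonpos_of_nonneg_of_nonpos hβ0.le
        (integral_nonpos fun z => max_le (hr' _) (hφ _))
    have hit : ∀ k θ, (M.Q^[k] 0) θ ≤ 0 := by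
      intro k
      induction k with
      | zero => intro θ; simp
      | succ k ih =>
        intro θ
        rw [Function.iterate_succ_apply']
        exact (hQneg _ ih θ).trans hc'.le
    have hψ0 : ∀ θ, ψ θ ≤ 0 := fun θ => le_of_tendsto' (hlim θ) fun k => hit k θ
    have h3 := hQneg ψ hψ0 θ
    rw [hQ] at h3
    exact mul_pos_of_neg_of_neg hs (h3.trans_lt hc')
  -- When δ < 1, max{r, ψ} ≥ r ≥ 0, so ψ ≥ c₀ > 0 directly from the fixed point equation.
  · have hr' : ∀ w, 0 ≤ M.r w := fun w => by
      have := hr w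
      exact (pos_of_mul_pos_right this (mul_pos h1 hs).le).le
    have hc' : 0 < M.c₀ := pos_of_mul_pos_right hc hs.le
    refine mul_pos hs ?_
    rw [← hQ, Q]
    exact add_pos_of_pos_of_nonneg hc' (mul_nonneg hβ0.le
      (integral_nonneg fun z => (hr' z.1).trans (le_max_left _ _)))

lemma isC1_Q (h : M.IsWeight ℓ K C) (hu : 0 < M.γu) (hψ : MemWeighted ℓ ψ) : IsC1 (M.Q ψ) := by
  obtain ⟨F, hF, hFQ⟩ := M.isC1_integral_thetaKernel hu (measurable_max_exit hψ.1)
    (h.integrable_max hψ)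
  refine ⟨fun x => M.c₀ + M.β * F x, contDiffOn_const.add (contDiffOn_const.mul hF), fun θ => ?_⟩
  beta_reduce
  rw [hFQ, Q]

/-- Both initial states are driven by the same shocks: with ρ ≥ 0 the larger θ gives the larger θ',
hence the larger wage, realization by realization. -/
lemma monotone_Q (h : M.IsWeight ℓ K C) (hβ0 : 0 < M.β) (hβ1 : M.β < 1) (hδ1 : M.δ ≠ 1)
    (hρ : 0 ≤ M.ρ) (hψ : MemWeighted ℓ ψ) (hmono : Monotone ψ) : Monotone (M.Q ψ) := by
  intro θ θ' hθ
  have hm := measurable_max_exit (M := M) hψ.1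
  have hi := fun θ => (M.integrable_thetaKernel_iff hm θ).1 (h.integrable_max hψ θ)
  rw [Q, Q, M.integral_thetaKernel hm, M.integral_thetaKernel hm]
  have hnext : ∀ u, M.nextTheta θ u ≤ M.nextTheta θ' u := fun u =>
    mul_le_mul_of_nonneg_right (Real.rpow_le_rpow (posReal_pos θ).le hθ hρ) (posReal_pos u).le
  have : ∫ s, max (M.r (M.next θ s).1) (ψ (M.next θ s).2) ∂M.shockLaw ≤
      ∫ s, max (M.r (M.next θ' s).1) (ψ (M.next θ' s).2) ∂M.shockLaw := by
    refine integral_mono (hi θ) (hi θ') fun s => max_le_max ?_ (hmono (hnext s.1))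
    refine (strictMono_r hβ1 hδ1).monotone ?_
    have hle : (M.nextTheta θ s.1 : ℝ) ≤ M.nextTheta θ' s.1 := hnext s.1
    change (s.2.2 : ℝ) + (M.nextTheta θ s.1 : ℝ) * (s.2.1 : ℝ) ≤
      (s.2.2 : ℝ) + (M.nextTheta θ' s.1 : ℝ) * (s.2.1 : ℝ)
    have := mul_le_mul_of_nonneg_right hle (posReal_pos s.2.1).le
    linarith
  gcongr

lemma monotone_fixed (h : M.IsWeight ℓ K C) (hβ0 : 0 < M.β) (hβ1 : M.β < 1) (hδ1 : M.δ ≠ 1)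
    (hρ : 0 ≤ M.ρ)
    (hlim : ∀ θ, Filter.Tendsto (fun k => (M.Q^[k] 0) θ) Filter.atTop (nhds (ψ θ))) :
    Monotone ψ := by
  have hit : ∀ k, Monotone (M.Q^[k] 0) := by
    intro k
    induction k with
    | zero => exact monotone_const
    | succ k ih =>
      rw [Function.iterate_succ_apply']
      exact monotone_Q h hβ0 hβ1 hδ1 hρ (h.memWeighted_iterate hβ0 k) ih
  exact fun x y hxy => le_of_tendsto_of_tendsto' (hlim x) (hlim y) fun k => hit k hxy

/-- Solution of the optimal stopping problem from the fixed point of `Q`. -/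
lemma solution_of_fixed (h : M.IsWeight ℓ K C) (hβ0 : 0 < M.β) (hβ1 : M.β < 1) (hδ1 : M.δ ≠ 1)
    (hρ0 : -1 < M.ρ) (hρ1 : M.ρ < 1) (hu : 0 < M.γu) (hη : 0 < M.γη)
    (hψ : MemWeighted ℓ ψ) (hQ : M.Q ψ = ψ) (hpos : ∀ θ, 0 < (1 - M.β) * (1 - M.δ) * ψ θ) :
    OptStop.ValueWellDefined M.kernel M.β (fun z => M.r z.1) (fun _ => M.c₀) ∧
    (∀ z, M.value z = max (M.r z.1) (ψ z.2)) ∧ M.contValue = ψ ∧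
    OptStop.IsOptimalPolicy M.kernel M.β (fun z => M.r z.1) (fun _ => M.c₀)
      {z | M.reservationWage ψ hpos z.2 ≤ z.1} := by
  have hN := weightedNorm_nonneg (f := ψ) h.pos
  obtain ⟨D, K', hD, hV⟩ := h.exists_isDriftWeight hβ0 hN
  set v : PosReal × PosReal → ℝ := fun z => max (M.r z.1) (ψ z.2) with hv
  have hvm : Measurable v := measurable_max_exit hψ.1
  -- The fixed point equation, read as: waiting one period and then collecting v is worth exactly ψ.
  have hcont : ∀ z, M.c₀ + M.β * ∫ y, v y ∂(M.kernel z) = ψ z.2 := fun z => congrFun hQ z.2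
  have hDℓ : ∀ z : PosReal × PosReal, 0 ≤ D * ℓ z.2 := fun z =>
    mul_nonneg (hN.trans hD) (h.pos _).le
  have hψD : ∀ z : PosReal × PosReal, |ψ z.2| ≤ D * ℓ z.2 := fun z =>
    (hψ.abs_le h.pos z.2).trans (mul_le_mul_of_nonneg_right hD (h.pos _).le)
  have hrV : ∀ z : PosReal × PosReal,
      ‖M.r z.1‖ₑ ≤ ENNReal.ofReal (|M.r z.1| + D * ℓ z.2) := fun z => by
    rw [Real.enorm_eq_ofReal_abs]
    exact ENNReal.ofReal_le_ofReal (by linarith [hDℓ z])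
  have hvV : ∀ z : PosReal × PosReal,
      ‖v z‖ₑ ≤ ENNReal.ofReal (|M.r z.1| + D * ℓ z.2) := fun z => by
    rw [Real.enorm_eq_ofReal_abs]
    refine ENNReal.ofReal_le_ofReal (abs_max_le_max_abs_abs.trans (max_le ?_ ?_))
    · linarith [hDℓ z]
    · linarith [hψD z, abs_nonneg (M.r z.1)]
  have hrm : Measurable fun z : PosReal × PosReal => M.r z.1 := M.measurable_r.comp measurable_fst
  have hPv : ∀ z, M.c₀ + M.β * ∫ y, v y ∂(M.kernel z) ≤ v z := fun z => by
    rw [hcont]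
    exact le_max_right _ _
  -- Regularity comes from the smoothing in Q, before ψ is known to be ψ*; the continuous threshold
  -- is needed to show that the policy stops in finite time.
  have hψC : IsC1 ψ := hQ ▸ isC1_Q h hu hψ
  have hwc : Continuous (M.reservationWage ψ hpos) :=
    (isC1_reservationWage hpos hψC).continuous.subtype_mk _
  have hwd := OptStop.valueWellDefined_of_excessive hV hβ0 hβ1 hrm hrV hvm hvV
    (fun z => le_max_left _ _) hPv
  obtain ⟨hval, hopt⟩ := OptStop.value_eq_and_isOptimalPolicy hV hβ0 hβ1 hrm hrV hvm hvV
    (fun z => le_max_left _ _) hPv (S := {z | M.reservationWage ψ hpos z.2 ≤ z.1})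
    (M.isFiniteStoppingTime_threshold hu hη hρ0 hρ1 hwc)
    (fun z hz => (max_eq_left ((reservationWage_le_iff hpos hβ1 hδ1 z.2 z.1).1 hz)).symm)
    (fun z hz => by
      rw [hcont]
      have hlt : M.r z.1 < ψ z.2 :=
        not_le.1 fun hle => hz ((reservationWage_le_iff hpos hβ1 hδ1 z.2 z.1).2 hle)
      exact (max_eq_right hlt.le).symm)
  refine ⟨hwd, hval, ?_, hopt⟩
  funext θ
  have hvalue : M.value = v := funext hval
  rw [contValue, hvalue]
  exact congrFun hQ θ

end FixedPoint

end JobSearch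

end

/-! ### Assembly of the proposition. -/

theorem mainTheorem12 (M : JobSearch)
    (hβ0 : 0 < M.β) (hβ1 : M.β < 1)
    (hδ0 : 0 ≤ M.δ) (hδ1 : M.δ ≠ 1)
    (hρ0 : -1 < M.ρ) (hρ1 : M.ρ < 1)
    (hcomp : 0 < M.comp)
    (hu : 0 < M.γu) (hξ : 0 < M.γξ) (hη : 0 < M.γη) :
    -- the expectations that enter the weight functions are finite
    (∀ k θ, Integrable (fun z : PosReal × PosReal => M.r z.1) (M.stateLaw k θ)) ∧
    -- the weight functions of the statement exist, for some and indeed every suitable `n`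
    (∃ n, M.β * M.m n < 1) ∧
    (∀ n, M.β * M.m n < 1 → ∃ a b m' d', M.IsAdmissible n a b m' d') ∧
    -- the value function and the continuation value function are well defined
    OptStop.ValueWellDefined M.kernel M.β (fun z => M.r z.1) (fun _ => M.c₀) ∧
    (∀ θ, Integrable M.value (M.thetaKernel θ)) ∧
    -- 1. `Q` is a contraction with unique fixed point `ψ*`
    (∀ n a b m' d', M.IsAdmissible n a b m' d' →
      (∀ θ, 0 < M.ell n a b m' d' θ) ∧
      (∀ ψ, MemWeighted (M.ell n a b m' d') ψ →
        ∀ θ, Integrable (fun z : PosReal × PosReal => max (M.r z.1) (ψ z.2)) (M.thetaKernel θ)) ∧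
      IsWeightedContraction (M.ell n a b m' d') M.Q ∧
      MemWeighted (M.ell n a b m' d') M.contValue ∧
      M.Q M.contValue = M.contValue ∧
      (∀ ψ, MemWeighted (M.ell n a b m' d') ψ → M.Q ψ = ψ → ψ = M.contValue)) ∧
    -- 2. value function, reservation wage and optimal policy; 3. smoothness; 4. monotonicity
    (∀ z, M.value z =
      max ((z.1 : ℝ) ^ (1 - M.δ) / ((1 - M.β) * (1 - M.δ))) (M.contValue z.2)) ∧
    (∃ wbar : PosReal → PosReal,
      (∀ θ w, M.r w = M.contValue θ ↔ w = wbar θ) ∧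
      (∀ θ, 0 < (1 - M.β) * (1 - M.δ) * M.contValue θ) ∧
      (∀ θ, (wbar θ : ℝ) = ((1 - M.β) * (1 - M.δ) * M.contValue θ) ^ (1 / (1 - M.δ))) ∧
      OptStop.IsOptimalPolicy M.kernel M.β (fun z => M.r z.1) (fun _ => M.c₀)
        {z | wbar z.2 ≤ z.1} ∧
      IsC1 (fun θ => (wbar θ : ℝ)) ∧
      (0 ≤ M.ρ → Monotone wbar)) ∧
    IsC1 M.contValue ∧
    Continuous M.value ∧
    (∀ θ, Monotone fun w => M.value (w, θ)) ∧
    (0 ≤ M.ρ → Monotone M.contValue ∧ ∀ w, Monotone fun θ => M.value (w, θ)) := by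
  have hweight : ∀ {n a b m' d'}, M.IsAdmissible n a b m' d' →
      ∃ C, M.IsWeight (M.ell n a b m' d') (M.m n + 2 * m') C := fun h =>
    h.isWeight hβ1 hδ0 hδ1 hρ0 hρ1
  obtain ⟨n, hn⟩ := M.exists_discount_m_lt_one hβ1 hρ0 hρ1
  obtain ⟨a, b, m', d', hadm⟩ := M.exists_isAdmissible hβ0 hβ1 hδ0 hδ1 hn
  obtain ⟨C, hw⟩ := hweight hadm
  obtain ⟨ψ, hψ, hQ, hlim⟩ := hw.exists_fixed hβ0
  have hpos := JobSearch.scaled_fixed_pos hβ0 hβ1 hδ1 hcomp hQ hlim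
  obtain ⟨hwd, hval, hcv, hopt⟩ :=
    JobSearch.solution_of_fixed hw hβ0 hβ1 hδ1 hρ0 hρ1 hu hη hψ hQ hpos
  have hvalue : M.value = fun z => max (M.r z.1) (ψ z.2) := funext hval
  have hC1 : IsC1 ψ := hQ ▸ JobSearch.isC1_Q hw hu hψ
  have hmono : 0 ≤ M.ρ → Monotone ψ := fun hρ =>
    JobSearch.monotone_fixed hw hβ0 hβ1 hδ1 hρ hlim
  refine ⟨fun k θ => ?_, ⟨n, hn⟩, fun n hn => M.exists_isAdmissible hβ0 hβ1 hδ0 hδ1 hn, hwd,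
    fun θ => ?_, fun n a b m' d' h => ?_, fun z => ?_, ?_, ?_, ?_, fun θ => ?_, fun hρ => ?_⟩
  · obtain ⟨A, B, -, -, h⟩ := M.absExit_bound hβ1 hδ0 hδ1 k
    exact (h θ).1
  · rw [hvalue]
    exact hw.integrable_max hψ θ
  · obtain ⟨C', hw'⟩ := hweight h
    -- Each admissible weight yields its own fixed point; all of them equal ψ*, whose definition
    -- involves no weight.
    obtain ⟨φ, hφ, hQφ, hlimφ⟩ := hw'.exists_fixed hβ0
    have hcφ := (JobSearch.solution_of_fixed hw' hβ0 hβ1 hδ1 hρ0 hρ1 hu hη hφ hQφ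
      (JobSearch.scaled_fixed_pos hβ0 hβ1 hδ1 hcomp hQφ hlimφ)).2.2.1
    rw [hcφ]
    exact ⟨hw'.pos, fun χ hχ => hw'.integrable_max hχ, hw'.isWeightedContraction_Q hβ0, hφ, hQφ,
      fun χ hχ hQχ => hw'.eq_of_fixed hβ0 hχ hφ hQχ hQφ⟩
  · rw [hval, hcv, M.r_eq hδ1]
  · rw [hcv]
    exact ⟨M.reservationWage ψ hpos, JobSearch.r_eq_iff hpos hβ1 hδ1, hpos, fun θ => rfl, hopt,
      JobSearch.isC1_reservationWage hpos hC1,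
      fun hρ => JobSearch.monotone_reservationWage hpos hβ1 hδ1 (hmono hρ)⟩
  · rw [hcv]
    exact hC1
  · rw [hvalue]
    have hr : Continuous M.r := by
      have : M.r = fun w : PosReal => (w : ℝ) ^ (1 - M.δ) / ((1 - M.β) * (1 - M.δ)) :=
        funext (M.r_eq hδ1)
      rw [this]
      exact (continuous_subtype_val.rpow_const fun w => Or.inl (posReal_pos w).ne').div_const _
    exact (hr.comp continuous_fst).max (hC1.continuous.comp continuous_snd)
  · intro w w' hww
    simp only [hval]
    exact max_le_max ((JobSearch.strictMono_r hβ1 hδ1).monotone hww) le_rfl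
  · rw [hcv]
    refine ⟨hmono hρ, fun w θ θ' hθ => ?_⟩
    simp only [hval]
    exact max_le_max le_rfl (hmono hρ hθ)
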